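/- **Setting.** *Terms.* Consider the monoidal signature with generators $\mathsf{del}\colon 0\to 1$, $\mathsf{cop}\colon 2\to 1$ and $\mathsf{cc}_\lambda\colon 1\to 2$ for every $\lambda\in[0,1]$. Terms $n\to m$ are built from the generators, the identity $\mathrm{id}\colon 1\to 1$, the empty term $0\to 0$ and the symmetry $\sigma\colon 2\to 2$ by sequential composition $;$ (in diagrammatic order) and parallel composition $\otimes$. Let $E$ be the set of equations, for all $\lambda,\mu\in[0,1]$, $$(\mathsf{cop}\otimes\mathrm{id});\mathsf{cop}=(\mathrm{id}\otimes\mathsf{cop});\mathsf{cop},\qquad \sigma;\mathsf{cop}=\mathsf{cop},\qquad (\mathsf{del}\otimes\mathrm{id});\mathsf{cop}=\mathrm{id},$$ $$\mathsf{cc}_\lambda;\mathsf{cop}=\mathrm{id},\qquad \mathsf{cc}_\lambda;(\mathsf{cc}_\mu\otimes\mathrm{id})=\mathsf{cc}_{\tilde\lambda};(\mathrm{id}\otimes\mathsf{cc}_{\tilde\mu}),\qquad \mathsf{cc}_\lambda;\sigma=\mathsf{cc}_{1-\lambda},$$ $$\mathsf{del};\mathsf{cc}_\lambda=\mathsf{del}\otimes\mathsf{del},\qquad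 \mathsf{cc}_0=\mathsf{del}\otimes\mathrm{id},\qquad \mathsf{cop};\mathsf{cc}_\lambda=(\mathsf{cc}_\lambda\otimes\mathsf{cc}_\lambda);(\mathrm{id}\otimes\sigma\otimes\mathrm{id});(\mathsf{cop}\otimes\mathsf{cop}),$$ where $\tilde\lambda=\lambda\mu$ and $\tilde\mu=\frac{\lambda-\lambda\mu}{1-\lambda\mu}$ (with $\frac00=1$). Two terms are *provably equal* if they are related by the smallest congruence for $;$ and $\otimes$ containing $E$ and the axioms of symmetric strict monoidal categories. *Derivable distances.* The statements $s=_\varepsilon t$ ($s,t\colon n\to m$ terms, $\varepsilon\in[0,\infty]$) that are *derivable* form the smallest set that contains, for every $\lambda\in[0,1]$, the axiom $$\mathsf{cc}_\lambda\otimes\mathsf{del}\;=_\lambda\;\mathsf{del}\otimes\mathsf{cc}_{1-\lambda}\tag{TV}$$ and is closed under the rules: $s=_0 t$ if $s,t$ are provably equal (Refl); $s=_\varepsilon t$ and $t=_{\varepsilon'}u$ give $s=_{\varepsilon+\varepsilon'}u$ (Triang); $s=_\infty t$ always (Bot); $s=_\varepsilon t$ and $\varepsilon\le\varepsilon'$ give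 $s=_{\varepsilon'}t$ (Mon); $s=_{\varepsilon_i}t$ for all $i\in I$ gives $s=_{\inf_i\varepsilon_i}t$ (Join); $s=_\varepsilon s'$ and $t=_{\varepsilon'}t'$ give $s;t=_{\varepsilon+\varepsilon'}s';t'$ ($\mathrm{Seq}_\oplus$) and $s\otimes t=_{\max(\varepsilon,\varepsilon')}s'\otimes t'$ ($\mathrm{Par}_\sqcap$), whenever these composites are defined; $s=_\varepsilon t$ gives $t=_\varepsilon s$ (Symm). *The source.* $\mathbf{S}$ is the category with objects the natural numbers and morphisms $n\to m$ the terms $n\to m$ up to provable equality, equipped on each hom-set with the pseudometric $d(s,t)=\inf\{\varepsilon : s=_\varepsilon t\text{ is derivable}\}$. *The target.* $\mathsf{FStoch}_{\mathsf{tv}}$ is the category with objects the natural numbers and morphisms $n\to m$ the $m\times n$ matrices with entries in $[0,1]$ and columns summing to $1$, composed by $A;B=BA$, equipped on each hom-set with $$\mathsf{tv}_{\max}(A,B)=\max_{j<n}\ \max_{S\subseteq\{0,\dots,m-1\}}\Bigl|\sum_{i\in S}A_{ij}-\sum_{i\in S}B_{ij}\Bigr|$$ (which is $0$ if $n=0$).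 In both categories composition satisfies $d(f;g,f';g')\le d(f,f')+d(g,g')$, so both are enriched over $[0,\infty]$-pseudometric spaces and nonexpansive maps with the monoidal product that adds distances. An *isomorphism of enriched categories* is a functor that is nonexpansive on hom-sets and has a strict inverse functor that is also nonexpansive on hom-sets. *The functor.* $F\colon\mathbf{S}\to\mathsf{FStoch}_{\mathsf{tv}}$ is the identity on objects; on morphisms it sends $\mathsf{del}$ to the $1\times 0$ matrix, $\mathsf{cop}$ to $[\,1\ \ 1\,]$, $\mathsf{cc}_\lambda$ to $\left[\begin{smallmatrix}\lambda\\ 1-\lambda\end{smallmatrix}\right]$, $\mathrm{id}$ and the empty term to identity matrices, $\sigma$ to $\left[\begin{smallmatrix}0&1\\1&0\end{smallmatrix}\right]$, $;$ to composition and $\otimes$ to the direct sum (block diagonal) of matrices. **Theorem.** $F\colon\mathbf{S}\to\mathsf{FStoch}_{\mathsf{tv}}$ is an isomorphism of enriched categories. Consequently, for all terms $s,t\colon n\to m$ and all $\varepsilon\in[0,\infty]$, the statement $s=_\varepsilon t$ is derivable if and only if $\mathsf{tv}_{\max}(F(s),F(t))\le\varepsilon$. -/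

import Mathlib

open CategoryTheory
open scoped ENNReal

noncomputable section

namespace QMon

/-! ## Terms over a monoidal signature and monoidal theories -/

/-- Terms over a monoidal signature `G`, where `G n m` is the set of generators of type `n → m`. -/
inductive Term (G : ℕ → ℕ → Type) : ℕ → ℕ → Type
  | gen {n m : ℕ} (g : G n m) : Term G n m
  | wire : Term G 1 1
  | empty : Term G 0 0
  | swap : Term G 2 2
  | seq {n m l : ℕ} (s : Term G n m) (t : Term G m l) : Term G n l
  | par {n n' m m' : ℕ} (s : Term G n n') (t : Term G m m') : Term G (n + m) (n' + m')

namespace Term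

variable {G : ℕ → ℕ → Type}

/-- Transport of a term along equalities of arity and coarity (needed only because the strict
associativity and unit laws for `+` on objects are propositional equalities). -/
def cast {n n' m m' : ℕ} (hn : n = n') (hm : m = m') (t : Term G n m) : Term G n' m' :=
  hn ▸ hm ▸ t

/-- The identity term on `n` wires. -/
def ident : (n : ℕ) → Term G n n
  | 0 => empty
  | n + 1 => par (ident n) wire

/-- The symmetry moving one wire past `n` wires, pasted from copies of `swap`. -/
def symmOne : (n : ℕ) → Term G (1 + n) (n + 1)
  | 0 => wire
  | n + 1 => seq (m := n + 2) (par (n := 1 + n) (n' := n + 1) (symmOne n) wire)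
      (par (n := n) (n' := n) (ident n) swap)

/-- The symmetry `m + n → n + m`, pasted from copies of `swap`. -/
def symm : (m n : ℕ) → Term G (m + n) (n + m)
  | 0, n => cast (Nat.zero_add n).symm rfl (ident n)
  | m + 1, n =>
      cast (Nat.add_assoc m 1 n).symm rfl
        (seq (m := m + n + 1) (par (m := 1 + n) (m' := n + 1) (ident m) (symmOne n))
          (par (n := m + n) (n' := n + m) (symm m n) wire))

end Term

open Term

/-- A (symmetric) monoidal theory: a signature and a set of equations between terms of the
same type. -/
structure MonoidalTheory where
  Gen : ℕ → ℕ → Type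
  eqn : ∀ {n m : ℕ}, Term Gen n m → Term Gen n m → Prop

/-- Provable equality in a monoidal theory: the smallest congruence with respect to `;` and `⊗`
containing the equations of the theory and the axioms of symmetric strict monoidal categories. -/
inductive MonoidalTheory.Provable (T : MonoidalTheory) :
    ∀ {n m : ℕ}, Term T.Gen n m → Term T.Gen n m → Prop
  | ax {n m : ℕ} {s t : Term T.Gen n m} (h : T.eqn s t) : Provable T s t
  | refl {n m : ℕ} (s : Term T.Gen n m) : Provable T s s
  | symm {n m : ℕ} {s t : Term T.Gen n m} (h : Provable T s t) : Provable T t s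
  | trans {n m : ℕ} {s t u : Term T.Gen n m} (h : Provable T s t) (h' : Provable T t u) :
      Provable T s u
  | seq_congr {n m l : ℕ} {s s' : Term T.Gen n m} {t t' : Term T.Gen m l}
      (h : Provable T s s') (h' : Provable T t t') : Provable T (seq s t) (seq s' t')
  | par_congr {n n' m m' : ℕ} {s s' : Term T.Gen n n'} {t t' : Term T.Gen m m'}
      (h : Provable T s s') (h' : Provable T t t') : Provable T (par s t) (par s' t')
  | seq_assoc {n m l k : ℕ} (s : Term T.Gen n m) (t : Term T.Gen m l) (u : Term T.Gen l k) :
      Provable T (seq (seq s t) u) (seq s (seq t u))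
  | par_assoc {n n' m m' l l' : ℕ}
      (s : Term T.Gen n n') (t : Term T.Gen m m') (u : Term T.Gen l l') :
      Provable T (par (par s t) u)
        (cast (Nat.add_assoc n m l).symm (Nat.add_assoc n' m' l').symm (par s (par t u)))
  | interchange {n m l n' m' l' : ℕ} (s : Term T.Gen n m) (t : Term T.Gen m l)
      (s' : Term T.Gen n' m') (t' : Term T.Gen m' l') :
      Provable T (par (seq s t) (seq s' t')) (seq (par s s') (par t t'))
  | empty_par {n m : ℕ} (s : Term T.Gen n m) :
      Provable T (par empty s) (cast (Nat.zero_add n).symm (Nat.zero_add m).symm s)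
  | par_empty {n m : ℕ} (s : Term T.Gen n m) : Provable T (par s empty) s
  | ident_seq {n m : ℕ} (s : Term T.Gen n m) : Provable T (seq (ident n) s) s
  | seq_ident {n m : ℕ} (s : Term T.Gen n m) : Provable T (seq s (ident m)) s
  | symm_natural {n n' m m' : ℕ} (s : Term T.Gen n n') (t : Term T.Gen m m') :
      Provable T (seq (par s t) (Term.symm n' m')) (seq (Term.symm n m) (par t s))
  | swap_swap : Provable T (seq swap swap) (ident 2)

/-! ## Quantitative monoidal theories over `[0,∞]`

The quantale is the Lawvere quantale: `[0,∞]` with the reversed order and addition. In terms of the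
usual order of `ℝ≥0∞`, its top is `0`, its bottom is `∞`, joins are infima and binary
meets are maxima. -/

/-- A `[0,∞]`-quantitative monoidal theory: `qeqn s t ε` is the axiom `s =_ε t`. -/
structure QuantTheory extends MonoidalTheory where
  qeqn : ∀ {n m : ℕ}, Term Gen n m → Term Gen n m → ℝ≥0∞ → Prop

namespace QuantTheory

/-- The closure of the quantitative equations under the rules Refl, Triang, Bot, Mon, Join,
together with Seq with `⊕`, Par with `⊓`, and Symm: `T.Derivable s t ε` means that `s =_ε t` is
in this closure. -/
inductive Derivable (T : QuantTheory) :
    ∀ {n m : ℕ}, Term T.Gen n m → Term T.Gen n m → ℝ≥0∞ → Prop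
  | ax {n m : ℕ} {s t : Term T.Gen n m} {ε : ℝ≥0∞} (h : T.qeqn s t ε) : Derivable T s t ε
  | refl {n m : ℕ} {s t : Term T.Gen n m} (h : T.Provable s t) : Derivable T s t 0
  | triang {n m : ℕ} {s t u : Term T.Gen n m} {ε ε' : ℝ≥0∞}
      (h : Derivable T s t ε) (h' : Derivable T t u ε') : Derivable T s u (ε + ε')
  | bot {n m : ℕ} (s t : Term T.Gen n m) : Derivable T s t ∞
  | mon {n m : ℕ} {s t : Term T.Gen n m} {ε ε' : ℝ≥0∞}
      (h : Derivable T s t ε) (hε : ε ≤ ε') : Derivable T s t ε'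
  | join {n m : ℕ} {s t : Term T.Gen n m} (S : Set ℝ≥0∞)
      (h : ∀ ε ∈ S, Derivable T s t ε) : Derivable T s t (sInf S)
  | seq {n m l : ℕ} {s s' : Term T.Gen n m} {t t' : Term T.Gen m l} {ε ε' : ℝ≥0∞}
      (h : Derivable T s s' ε) (h' : Derivable T t t' ε') :
      Derivable T (seq s t) (seq s' t') (ε + ε')
  | par {n n' m m' : ℕ} {s s' : Term T.Gen n n'} {t t' : Term T.Gen m m'} {ε ε' : ℝ≥0∞}
      (h : Derivable T s s' ε) (h' : Derivable T t t' ε') :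
      Derivable T (par s t) (par s' t') (max ε ε')
  | symm {n m : ℕ} {s t : Term T.Gen n m} {ε : ℝ≥0∞} (h : Derivable T s t ε) :
      Derivable T t s ε

/-- The syntactic distance of two terms: the quantale join of all derivable `ε`. -/
def termDist (T : QuantTheory) {n m : ℕ} (s t : Term T.Gen n m) : ℝ≥0∞ :=
  sInf {ε | T.Derivable s t ε}

lemma derivable_termDist (T : QuantTheory) {n m : ℕ} (s t : Term T.Gen n m) :
    T.Derivable s t (T.termDist s t) :=
  Derivable.join _ fun _ h => h

lemma termDist_le (T : QuantTheory) {n m : ℕ} {s t : Term T.Gen n m} {ε : ℝ≥0∞}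
    (h : T.Derivable s t ε) : T.termDist s t ≤ ε :=
  sInf_le h

lemma termDist_congr (T : QuantTheory) {n m : ℕ} {s t s' t' : Term T.Gen n m}
    (hs : T.Provable s s') (ht : T.Provable t t') : T.termDist s t = T.termDist s' t' := by
  apply le_antisymm
  · simpa using T.termDist_le
      (((Derivable.refl hs).triang (T.derivable_termDist s' t')).triang (Derivable.refl ht.symm))
  · simpa using T.termDist_le
      (((Derivable.refl hs.symm).triang (T.derivable_termDist s t)).triang (Derivable.refl ht))

end QuantTheory

/-! ## Enrichment over `[0,∞]`-pseudometric spaces -/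

/-- A category enriched over the category of `[0,∞]`-pseudometric spaces and nonexpansive maps,
with the monoidal product that adds distances: hom-sets are pseudometric spaces and
composition is nonexpansive. -/
class PMetEnriched (C : Type) [Category.{0} C] where
  homSpace : ∀ a b : C, PseudoEMetricSpace (a ⟶ b)
  comp_nonexpansive : ∀ {a b c : C} (f f' : a ⟶ b) (g g' : b ⟶ c),
    edist (f ≫ g) (f' ≫ g') ≤ edist f f' + edist g g'

attribute [instance, reducible] PMetEnriched.homSpace

section

variable {C D : Type} [Category.{0} C] [Category.{0} D] [PMetEnriched C] [PMetEnriched D]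

/-- A functor between enriched categories is enriched if it is nonexpansive on every hom-set. -/
def IsEnrichedFunctor (F : C ⥤ D) : Prop :=
  ∀ (a b : C) (f g : a ⟶ b), edist (F.map f) (F.map g) ≤ edist f g

/-- `F` is an isomorphism of enriched categories: it is an enriched functor and it has a
(strict) inverse which is an enriched functor. -/
def IsEnrichedIso (F : C ⥤ D) : Prop :=
  IsEnrichedFunctor F ∧
    ∃ G : D ⥤ C, IsEnrichedFunctor G ∧ F ⋙ G = 𝟭 C ∧ G ⋙ F = 𝟭 D

end

/-! ## The syntactic category -/

/-- Terms up to provable equality. -/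
def MonoidalTheory.setoid (T : MonoidalTheory) (n m : ℕ) : Setoid (Term T.Gen n m) where
  r := T.Provable
  iseqv := ⟨.refl, .symm, .trans⟩

/-- The syntactic category generated by a quantitative monoidal theory; its objects are the
natural numbers. -/
def Syn (_T : QuantTheory) : Type := ℕ

instance (T : QuantTheory) : Category.{0} (Syn T) where
  Hom n m := Quotient (T.setoid n m)
  id n := Quotient.mk _ (ident n)
  comp {n m l} := Quotient.map₂ (sa := T.setoid n m) (sb := T.setoid m l) (sc := T.setoid n l)
    seq (fun _ _ h _ _ h' => .seq_congr h h')
  id_comp f := Quotient.inductionOn f fun s => Quotient.sound (.ident_seq s)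
  comp_id f := Quotient.inductionOn f fun s => Quotient.sound (.seq_ident s)
  assoc f g h := Quotient.inductionOn₃ f g h fun s t u => Quotient.sound (.seq_assoc s t u)

instance (T : QuantTheory) : PMetEnriched (Syn T) where
  homSpace n m :=
    { edist := Quotient.lift₂ (s₁ := T.setoid n m) (s₂ := T.setoid n m) T.termDist
        fun _ _ _ _ h h' => T.termDist_congr h h'
      edist_self := fun f => Quotient.inductionOn f fun s =>
        le_antisymm (T.termDist_le (.refl (.refl s))) bot_le
      edist_comm := fun f g => Quotient.inductionOn₂ f g fun s t =>
        le_antisymm (T.termDist_le (T.derivable_termDist t s).symm)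
          (T.termDist_le (T.derivable_termDist s t).symm)
      edist_triangle := fun f g h => Quotient.inductionOn₃ f g h fun s t u =>
        T.termDist_le ((T.derivable_termDist s t).triang (T.derivable_termDist t u)) }
  comp_nonexpansive f f' g g' :=
    Quotient.inductionOn₂ f f' fun s s' => Quotient.inductionOn₂ g g' fun t t' =>
      T.termDist_le ((T.derivable_termDist s s').seq (T.derivable_termDist t t'))

/-! ## Stochastic matrices -/

/-- A stochastic matrix `n → m`: an `m × n` matrix with entries in `[0,1]` and columns
summing to `1`. -/
@[ext]
structure StochMat (n m : ℕ) where
  mat : Matrix (Fin m) (Fin n) ℝ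
  mem_Icc : ∀ i j, mat i j ∈ Set.Icc (0 : ℝ) 1
  sum_col : ∀ j, ∑ i, mat i j = 1

namespace StochMat

/-- Nonnegativity and column sums `1` suffice for a stochastic matrix. -/
def ofNonneg {n m : ℕ} (A : Matrix (Fin m) (Fin n) ℝ) (h0 : ∀ i j, 0 ≤ A i j)
    (h1 : ∀ j, ∑ i, A i j = 1) : StochMat n m where
  mat := A
  mem_Icc i j := ⟨h0 i j, h1 j ▸ Finset.single_le_sum (f := fun i => A i j)
    (fun i _ => h0 i j) (Finset.mem_univ i)⟩
  sum_col := h1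

/-- Identity matrix. -/
def one (n : ℕ) : StochMat n n :=
  ofNonneg 1 (fun i j => by rw [Matrix.one_apply]; split_ifs <;> norm_num)
    (fun j => by simp [Matrix.one_apply])

/-- Composition `A ; B` is the matrix product `B * A`. -/
def comp {n m l : ℕ} (A : StochMat n m) (B : StochMat m l) : StochMat n l :=
  ofNonneg (B.mat * A.mat)
    (fun i j => by
      rw [Matrix.mul_apply]
      exact Finset.sum_nonneg fun k _ => mul_nonneg (B.mem_Icc i k).1 (A.mem_Icc k j).1)
    (fun j => by
      simp only [Matrix.mul_apply]
      rw [Finset.sum_comm]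
      simp [← Finset.sum_mul, B.sum_col, A.sum_col])

lemma one_comp {n m : ℕ} (A : StochMat n m) : (one n).comp A = A :=
  StochMat.ext (Matrix.mul_one A.mat)

lemma comp_one {n m : ℕ} (A : StochMat n m) : A.comp (one m) = A :=
  StochMat.ext (Matrix.one_mul A.mat)

lemma comp_assoc {n m l k : ℕ} (A : StochMat n m) (B : StochMat m l) (C : StochMat l k) :
    (A.comp B).comp C = A.comp (B.comp C) :=
  StochMat.ext (Matrix.mul_assoc C.mat B.mat A.mat).symm

/-- Monoidal product: the direct sum, with blocks `A` and `B` on the diagonal. -/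
def directSum {n n' m m' : ℕ} (A : StochMat n n') (B : StochMat m m') :
    StochMat (n + m) (n' + m') :=
  ofNonneg (Matrix.reindex finSumFinEquiv finSumFinEquiv (Matrix.fromBlocks A.mat 0 0 B.mat))
    (fun i j => by
      refine Fin.addCases (fun i => ?_) (fun i => ?_) i <;>
      refine Fin.addCases (fun j => ?_) (fun j => ?_) j <;>
      simp [(A.mem_Icc _ _).1, (B.mem_Icc _ _).1])
    (fun j => by
      rw [Fin.sum_univ_add]
      refine Fin.addCases (fun j => ?_) (fun j => ?_) j <;>
      simp [A.sum_col, B.sum_col])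

/-- The symmetry exchanging two wires. -/
def swap : StochMat 2 2 :=
  ofNonneg !![0, 1; 1, 0] (fun i j => by fin_cases i <;> fin_cases j <;> simp)
    (fun j => by fin_cases j <;> simp)

end StochMat

/-- Total variation distance of two distributions on a finite set: the largest difference
between the probabilities of an event (a finite supremum, hence a maximum). -/
def tv {m : ℕ} (p q : Fin m → ℝ) : ℝ≥0∞ :=
  ⨆ S : Finset (Fin m), ENNReal.ofReal |∑ i ∈ S, p i - ∑ i ∈ S, q i|

/-- Column-wise maximum of total variation distances. -/
def tvmax {n m : ℕ} (A B : StochMat n m) : ℝ≥0∞ :=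
  ⨆ j : Fin n, tv (fun i => A.mat i j) (fun i => B.mat i j)

lemma tv_self {m : ℕ} (p : Fin m → ℝ) : tv p p = 0 := by simp [tv]

lemma tv_comm {m : ℕ} (p q : Fin m → ℝ) : tv p q = tv q p := by
  simp only [tv, abs_sub_comm]

lemma tv_triangle {m : ℕ} (p q r : Fin m → ℝ) : tv p r ≤ tv p q + tv q r := by
  refine iSup_le fun S => ?_
  calc ENNReal.ofReal |∑ i ∈ S, p i - ∑ i ∈ S, r i|
      ≤ ENNReal.ofReal (|∑ i ∈ S, p i - ∑ i ∈ S, q i| + |∑ i ∈ S, q i - ∑ i ∈ S, r i|) :=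
        ENNReal.ofReal_le_ofReal (abs_sub_le _ _ _)
    _ = _ := ENNReal.ofReal_add (abs_nonneg _) (abs_nonneg _)
    _ ≤ _ := add_le_add
        (le_iSup (fun S : Finset (Fin m) => ENNReal.ofReal |∑ i ∈ S, p i - ∑ i ∈ S, q i|) S)
        (le_iSup (fun S : Finset (Fin m) => ENNReal.ofReal |∑ i ∈ S, q i - ∑ i ∈ S, r i|) S)

/-- Applying a stochastic matrix to two distributions does not increase their distance. -/
lemma tv_mulVec_le {m l : ℕ} (M : StochMat m l) (p q : Fin m → ℝ)  :
    tv (M.mat.mulVec p) (M.mat.mulVec q) ≤ tv p q := by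
  refine iSup_le fun S => ?_
  have key : ∀ p q : Fin m → ℝ, ∃ U : Finset (Fin m),
      ∑ i ∈ S, M.mat.mulVec p i - ∑ i ∈ S, M.mat.mulVec q i ≤
        |∑ k ∈ U, p k - ∑ k ∈ U, q k| := by
    intro p q
    refine ⟨Finset.univ.filter fun k => q k ≤ p k, le_trans ?_ (le_abs_self _)⟩
    have e : ∑ i ∈ S, M.mat.mulVec p i - ∑ i ∈ S, M.mat.mulVec q i =
        ∑ k, (∑ i ∈ S, M.mat i k) * (p k - q k) := by
      simp only [Matrix.mulVec, dotProduct]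
      rw [Finset.sum_comm, Finset.sum_comm (s := S), ← Finset.sum_sub_distrib]
      refine Finset.sum_congr rfl fun k _ => ?_
      rw [← Finset.sum_mul, ← Finset.sum_mul]; ring
    rw [e, ← Finset.sum_sub_distrib, Finset.sum_filter]
    refine Finset.sum_le_sum fun k _ => ?_
    have h0 : 0 ≤ ∑ i ∈ S, M.mat i k := Finset.sum_nonneg fun i _ => (M.mem_Icc i k).1
    have h1 : ∑ i ∈ S, M.mat i k ≤ 1 := by
      rw [← M.sum_col k]
      exact Finset.sum_le_sum_of_subset_of_nonneg (Finset.subset_univ _)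
        fun i _ _ => (M.mem_Icc i k).1
    split_ifs with h <;> nlinarith
  have fin : ∃ U : Finset (Fin m), |∑ i ∈ S, M.mat.mulVec p i - ∑ i ∈ S, M.mat.mulVec q i| ≤
      |∑ k ∈ U, p k - ∑ k ∈ U, q k| := by
    rcases le_total 0 (∑ i ∈ S, M.mat.mulVec p i - ∑ i ∈ S, M.mat.mulVec q i) with h | h
    · rw [abs_of_nonneg h]; exact key p q
    · rw [abs_of_nonpos h, neg_sub]
      obtain ⟨U, hU⟩ := key q p
      exact ⟨U, by rwa [abs_sub_comm]⟩
  obtain ⟨U, hU⟩ := fin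
  exact (ENNReal.ofReal_le_ofReal hU).trans
    (le_iSup (fun S : Finset (Fin m) => ENNReal.ofReal |∑ i ∈ S, p i - ∑ i ∈ S, q i|) U)

/-- Convex combinations of columns are at most as far apart as the columns. -/
lemma tv_mulVec_le_tvmax {m l : ℕ} (M N : StochMat m l) (p : Fin m → ℝ) (h0 : ∀ k, 0 ≤ p k)
    (h1 : ∑ k, p k = 1) : tv (M.mat.mulVec p) (N.mat.mulVec p) ≤ tvmax M N := by
  refine iSup_le fun S => ?_
  have e : ∑ i ∈ S, M.mat.mulVec p i - ∑ i ∈ S, N.mat.mulVec p i =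
      ∑ k, p k * (∑ i ∈ S, M.mat i k - ∑ i ∈ S, N.mat i k) := by
    simp only [Matrix.mulVec, dotProduct]
    rw [Finset.sum_comm, Finset.sum_comm (s := S), ← Finset.sum_sub_distrib]
    refine Finset.sum_congr rfl fun k _ => ?_
    rw [← Finset.sum_mul, ← Finset.sum_mul]; ring
  have hk : ∀ k, ENNReal.ofReal |∑ i ∈ S, M.mat i k - ∑ i ∈ S, N.mat i k| ≤ tvmax M N := fun k =>
    (le_iSup (fun S : Finset (Fin l) =>
      ENNReal.ofReal |∑ i ∈ S, M.mat i k - ∑ i ∈ S, N.mat i k|) S).trans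
    (le_iSup (fun j : Fin m => tv (fun i => M.mat i j) (fun i => N.mat i j)) k)
  calc ENNReal.ofReal |∑ i ∈ S, M.mat.mulVec p i - ∑ i ∈ S, N.mat.mulVec p i|
      ≤ ENNReal.ofReal (∑ k, p k * |∑ i ∈ S, M.mat i k - ∑ i ∈ S, N.mat i k|) := by
        rw [e]
        refine ENNReal.ofReal_le_ofReal ((Finset.abs_sum_le_sum_abs _ _).trans_eq ?_)
        exact Finset.sum_congr rfl fun k _ => by rw [abs_mul, abs_of_nonneg (h0 k)]
    _ = ∑ k, ENNReal.ofReal (p k) *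
          ENNReal.ofReal |∑ i ∈ S, M.mat i k - ∑ i ∈ S, N.mat i k| := by
        rw [ENNReal.ofReal_sum_of_nonneg fun k _ => mul_nonneg (h0 k) (abs_nonneg _)]
        exact Finset.sum_congr rfl fun k _ => ENNReal.ofReal_mul (h0 k)
    _ ≤ ∑ k, ENNReal.ofReal (p k) * tvmax M N :=
        Finset.sum_le_sum fun k _ => mul_le_mul_right (hk k) _
    _ = tvmax M N := by
        rw [← Finset.sum_mul, ← ENNReal.ofReal_sum_of_nonneg fun k _ => h0 k, h1]; simp

/-- The pseudometric `tvmax` on stochastic matrices of a given size. -/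
instance StochMat.instPMet (n m : ℕ) : PseudoEMetricSpace (StochMat n m) where
  edist := tvmax
  edist_self A := by simp [tvmax, tv_self]
  edist_comm A B := by simp only [tvmax, tv_comm]
  edist_triangle A B C := iSup_le fun j => (tv_triangle _ _ _).trans (add_le_add
    (le_iSup (fun j => tv (fun i => A.mat i j) (fun i => B.mat i j)) j)
    (le_iSup (fun j => tv (fun i => B.mat i j) (fun i => C.mat i j)) j))

lemma tvmax_comp_le {n m l : ℕ} (A A' : StochMat n m) (B B' : StochMat m l) :
    tvmax (A.comp B) (A'.comp B') ≤ tvmax A A' + tvmax B B' := by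
  refine iSup_le fun j => ?_
  refine (tv_triangle _ (B.mat.mulVec fun k => A'.mat k j) _).trans (add_le_add ?_ ?_)
  · exact (tv_mulVec_le B _ _).trans
      (le_iSup (fun j => tv (fun i => A.mat i j) (fun i => A'.mat i j)) j)
  · exact tv_mulVec_le_tvmax B B' _ (fun k => (A'.mem_Icc k j).1) (A'.sum_col j)

/-- The category of natural numbers and stochastic matrices. -/
def FStoch : Type := ℕ

instance : Category.{0} FStoch where
  Hom n m := StochMat n m
  id n := StochMat.one n
  comp A B := StochMat.comp A B
  id_comp A := StochMat.one_comp A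
  comp_id A := StochMat.comp_one A
  assoc A B C := StochMat.comp_assoc A B C

/-- The enrichment by `tvmax`. -/
instance : PMetEnriched FStoch where
  homSpace n m := StochMat.instPMet n m
  comp_nonexpansive A A' B B' := tvmax_comp_le A A' B B'

/-! ## Convex algebras and the axiom (TV) -/

/-- The generators of the theory of convex algebras. -/
inductive ConvGen : ℕ → ℕ → Type
  | del : ConvGen 0 1
  | cop : ConvGen 2 1
  | cc (r : unitInterval) : ConvGen 1 2

/-- The unit `0 → 1`. -/
abbrev del : Term ConvGen 0 1 := gen .del

/-- The multiplication `2 → 1`. -/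
abbrev cop : Term ConvGen 2 1 := gen .cop

/-- The convex choice `1 → 2`, with weight `r` on the first and `1 - r` on the second output. -/
abbrev cc (r : unitInterval) : Term ConvGen 1 2 := gen (.cc r)

lemma reassocWeight_mem (r u : unitInterval) (h : (r : ℝ) * u ≠ 1) :
    ((r : ℝ) - r * u) / (1 - r * u) ∈ Set.Icc (0 : ℝ) 1 := by
  have hr0 := r.2.1
  have hr1 := r.2.2
  have hu0 := u.2.1
  have hu1 := u.2.2
  have h1 : (r : ℝ) * u ≤ 1 := by nlinarith
  have h2 : 0 < 1 - (r : ℝ) * u := sub_pos.2 (lt_of_le_of_ne h1 h)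
  exact ⟨div_nonneg (by nlinarith) h2.le, (div_le_one h2).2 (by linarith)⟩

/-- The weight `(r - r u) / (1 - r u)`, with `0 / 0 = 1`. -/
def reassocWeight (r u : unitInterval) : unitInterval :=
  open Classical in
  if h : (r : ℝ) * u = 1 then 1 else ⟨_, reassocWeight_mem r u h⟩

/-- The equations of the theory of convex algebras. -/
inductive ConvEq : ∀ {n m : ℕ}, Term ConvGen n m → Term ConvGen n m → Prop
  | assoc : ConvEq (n := 3) (m := 1) (seq (m := 2) (par cop wire) cop)
      (seq (m := 2) (par wire cop) cop)
  | comm : ConvEq (seq Term.swap cop) cop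
  | unit : ConvEq (n := 1) (m := 1) (seq (m := 2) (par del wire) cop) wire
  | idemp (r : unitInterval) : ConvEq (seq (cc r) cop) wire
  | convassoc (r u : unitInterval) :
      ConvEq (n := 1) (m := 3) (seq (m := 2) (cc r) (par (cc u) wire))
        (seq (m := 2) (cc (r * u)) (par wire (cc (reassocWeight r u))))
  | convcomm (r : unitInterval) : ConvEq (seq (cc r) Term.swap) (cc (unitInterval.symm r))
  | natdel (r : unitInterval) : ConvEq (n := 0) (m := 2) (seq del (cc r)) (par del del)
  | zprob : ConvEq (n := 1) (m := 2) (cc 0) (par del wire)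
  | cccop (r : unitInterval) :
      ConvEq (n := 2) (m := 2) (seq cop (cc r))
        (seq (m := 4) (par (cc r) (cc r))
          (seq (m := 4) (par (par wire Term.swap) wire) (par cop cop)))

/-- The monoidal theory of convex algebras. -/
abbrev ConvAlg : MonoidalTheory where
  Gen := ConvGen
  eqn := ConvEq

/-- The axioms (TV): `cc r ⊗ del =_r del ⊗ cc (1 - r)`, for every `r` in `[0,1]`. -/
inductive TVEq : ∀ {n m : ℕ}, Term ConvGen n m → Term ConvGen n m → ℝ≥0∞ → Prop
  | tv (r : unitInterval) :
      TVEq (n := 1) (m := 3) (par (cc r) del) (par del (cc (unitInterval.symm r)))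
        (ENNReal.ofReal r)

/-- The `[0,∞]`-quantitative monoidal theory: convex algebras with the axioms (TV). -/
abbrev BarAlg : QuantTheory where
  toMonoidalTheory := ConvAlg
  qeqn := TVEq

/-! ## The functor to stochastic matrices -/

/-- The stochastic matrices assigned to the generators. -/
def interpGen : {n m : ℕ} → ConvGen n m → StochMat n m
  | _, _, .del => .ofNonneg (fun _ j => j.elim0) (fun _ j => j.elim0) (fun j => j.elim0)
  | _, _, .cop => .ofNonneg !![1, 1] (fun i j => by fin_cases i; fin_cases j <;> simp)
      (fun j => by fin_cases j <;> simp)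
  | _, _, .cc r => .ofNonneg !![(r : ℝ); 1 - (r : ℝ)]
      (fun i j => by fin_cases j; fin_cases i <;> simp [r.2.1, r.2.2])
      (fun j => by fin_cases j; simp)

/-- The stochastic matrix denoted by a term, for a given assignment on generators: `;` is sent to
composition, `⊗` to direct sum, and the basic identities and symmetry to the
corresponding matrices. -/
def interp {G : ℕ → ℕ → Type} (φ : ∀ {n m : ℕ}, G n m → StochMat n m) :
    {n m : ℕ} → Term G n m → StochMat n m
  | _, _, .gen g => φ g
  | _, _, .wire => .one 1
  | _, _, .empty => .one 0
  | _, _, .swap => .swap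
  | _, _, .seq s t => (interp φ s).comp (interp φ t)
  | _, _, .par s t => (interp φ s).directSum (interp φ t)

/-! ### Soundness of provable equality -/

section

variable {G : ℕ → ℕ → Type} {φ : ∀ {n m : ℕ}, G n m → StochMat n m}

/-- The entries of a stochastic matrix, extended by zero to all pairs of natural numbers. -/
def ent {n m : ℕ} (A : StochMat n m) (i j : ℕ) : ℝ :=
  if h : i < m ∧ j < n then A.mat ⟨i, h.1⟩ ⟨j, h.2⟩ else 0

lemma ent_ext {n m : ℕ} {A B : StochMat n m} (h : ∀ i j, ent A i j = ent B i j) : A = B := by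
  ext i j
  simpa [ent] using h i j

lemma ent_eq_zero {n m : ℕ} (A : StochMat n m) {i j : ℕ} (h : m ≤ i ∨ n ≤ j) :
    ent A i j = 0 := dif_neg (by omega)

lemma ent_comp {n m l : ℕ} (A : StochMat n m) (B : StochMat m l) (i j : ℕ) :
    ent (A.comp B) i j = ∑ k ∈ Finset.range m, ent B i k * ent A k j := by
  by_cases h : i < l ∧ j < n
  · rw [Finset.sum_range]
    simp [ent, h, StochMat.comp, StochMat.ofNonneg, Matrix.mul_apply]
  · rw [ent, dif_neg h]
    symm
    refine Finset.sum_eq_zero fun k _ => ?_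
    by_cases hi : i < l
    · rw [ent_eq_zero A (by omega), mul_zero]
    · rw [ent_eq_zero B (by omega), zero_mul]

lemma ent_directSum {n n' m m' : ℕ} (A : StochMat n n') (B : StochMat m m') (i j : ℕ) :
    ent (A.directSum B) i j =
      if i < n' ∧ j < n then ent A i j
      else if n' ≤ i ∧ n ≤ j then ent B (i - n') (j - n) else 0 := by
  by_cases h : i < n' + m' ∧ j < n + m
  · obtain ⟨hi, hj⟩ := h
    obtain ⟨i, rfl⟩ : ∃ x : Fin (n' + m'), x.1 = i := ⟨⟨i, hi⟩, rfl⟩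
    obtain ⟨j, rfl⟩ : ∃ x : Fin (n + m), x.1 = j := ⟨⟨j, hj⟩, rfl⟩
    have e : ent (A.directSum B) i j = (A.directSum B).mat i j := by simp [ent]
    rw [e]
    refine Fin.addCases (fun i => ?_) (fun i => ?_) i <;>
    refine Fin.addCases (fun j => ?_) (fun j => ?_) j <;>
    simp [StochMat.directSum, StochMat.ofNonneg, ent]
  · rw [ent_eq_zero _ (by omega)]
    split_ifs with h1 h2
    · omega
    · rw [ent_eq_zero _ (by omega)]
    · rfl

lemma ent_interp_cast {n n' m m' : ℕ} (hn : n = n') (hm : m = m') (t : Term G n m)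
    (i j : ℕ) : ent (interp φ (cast hn hm t)) i j = ent (interp φ t) i j := by
  subst hn hm; rfl

/-- `A` is the 0/1 matrix of the function `f`. -/
def IsMap {n m : ℕ} (A : StochMat n m) (f : ℕ → ℕ) : Prop :=
  (∀ j < n, f j < m) ∧ ∀ i j, ent A i j = if j < n ∧ i = f j then 1 else 0

lemma IsMap.congr {n m : ℕ} {A : StochMat n m} {f g : ℕ → ℕ} (h : IsMap A f)
    (hfg : ∀ j < n, f j = g j) : IsMap A g := by
  refine ⟨fun j hj => hfg j hj ▸ h.1 j hj, fun i j => ?_⟩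
  rw [h.2]
  by_cases hj : j < n
  · rw [hfg j hj]
  · simp [hj]

lemma isMap_one (n : ℕ) : IsMap (StochMat.one n) id := by
  refine ⟨fun j hj => hj, fun i j => ?_⟩
  by_cases h : i < n ∧ j < n
  · simp [ent, h, StochMat.one, StochMat.ofNonneg, Matrix.one_apply]
  · rw [ent_eq_zero _ (by omega), if_neg]
    simp only [id]; omega

lemma isMap_swap : IsMap StochMat.swap (fun j => 1 - j) := by
  refine ⟨fun j hj => by dsimp only; omega, fun i j => ?_⟩
  by_cases h : i < 2 ∧ j < 2
  · obtain ⟨hi, hj⟩ := h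
    interval_cases i <;> interval_cases j <;> simp [ent, StochMat.swap, StochMat.ofNonneg]
  · rw [ent_eq_zero _ (by omega), if_neg]
    dsimp only; omega

/-- Precomposing with the matrix of a function selects columns. -/
lemma IsMap.ent_comp_left {n m l : ℕ} {A : StochMat n m} {f : ℕ → ℕ} (h : IsMap A f)
    (B : StochMat m l) (i j : ℕ) :
    ent (A.comp B) i j = if j < n then ent B i (f j) else 0 := by
  rw [ent_comp]
  split_ifs with hj
  · rw [Finset.sum_eq_single (f j)]
    · simp [h.2, hj]
    · intro k _ hk
      simp [h.2, hk]
    · intro hk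
      exact absurd (Finset.mem_range.2 (h.1 j hj)) hk
  · exact Finset.sum_eq_zero fun k _ => by simp [h.2, hj]

lemma IsMap.comp {n m l : ℕ} {A : StochMat n m} {B : StochMat m l} {f g : ℕ → ℕ}
    (h : IsMap A f) (h' : IsMap B g) : IsMap (A.comp B) (fun j => g (f j)) := by
  refine ⟨fun j hj => h'.1 _ (h.1 _ hj), fun i j => ?_⟩
  rw [h.ent_comp_left, h'.2]
  by_cases hj : j < n
  · simp [hj, h.1 j hj]
  · simp [hj]

lemma IsMap.directSum {n n' m m' : ℕ} {A : StochMat n n'} {B : StochMat m m'} {f g : ℕ → ℕ}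
    (h : IsMap A f) (h' : IsMap B g) :
    IsMap (A.directSum B) (fun j => if j < n then f j else n' + g (j - n)) := by
  constructor
  · intro j hj
    by_cases hn : j < n
    · have := h.1 j hn
      simp only [hn, if_true]; omega
    · have := h'.1 (j - n) (by omega)
      simp only [hn, if_false]; omega
  · intro i j
    rw [ent_directSum, h.2, h'.2]
    by_cases hn : j < n
    · have := h.1 j hn
      simp only [hn, if_true, and_true, true_and]
      split_ifs <;> first | rfl | (exfalso; omega)
    · simp only [hn, if_false, and_false, false_and]
      split_ifs <;> first | rfl | (exfalso; omega)

lemma IsMap.eq {n m : ℕ} {A B : StochMat n m} {f : ℕ → ℕ} (h : IsMap A f) (h' : IsMap B f) :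
    A = B :=
  ent_ext fun i j => by rw [h.2, h'.2]

/-- Postcomposing with the matrix of an injection relabels rows. -/
lemma IsMap.ent_comp_right {n m l : ℕ} {B : StochMat m l} {f : ℕ → ℕ} (h : IsMap B f)
    (hf : ∀ j < m, ∀ k < m, f j = f k → j = k) (A : StochMat n m) (i j : ℕ) (hi : i < m) :
    ent (A.comp B) (f i) j = ent A i j := by
  rw [ent_comp, Finset.sum_eq_single i]
  · simp [h.2, hi]
  · intro k hk hki
    have : f i ≠ f k := fun e => hki (hf i hi k (Finset.mem_range.1 hk) e).symm
    simp [h.2, this]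
  · intro hk
    exact absurd (Finset.mem_range.2 hi) hk

lemma isMap_ident (n : ℕ) : IsMap (interp φ (ident n)) id := by
  induction n with
  | zero => exact isMap_one 0
  | succ n ih =>
    refine (ih.directSum (isMap_one 1)).congr fun j hj => ?_
    simp only [id]
    split_ifs <;> omega

lemma isMap_symmOne (n : ℕ) :
    IsMap (interp φ (symmOne n)) (fun j => if j < 1 then n else j - 1) := by
  induction n with
  | zero =>
    refine (isMap_one 1).congr fun j hj => ?_
    simp only [id]
    split_ifs; omega
  | succ n ih =>
    refine ((ih.directSum (isMap_one 1)).comp ((isMap_ident n).directSum isMap_swap)).congr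
      fun j hj => ?_
    simp only [id]
    split_ifs <;> omega

lemma IsMap.cast {n n' m m' : ℕ} (hn : n = n') (hm : m = m') {t : Term G n m} {f : ℕ → ℕ}
    (h : IsMap (interp φ t) f) : IsMap (interp φ (Term.cast hn hm t)) f := by
  subst hn hm; exact h

lemma isMap_symm (m n : ℕ) :
    IsMap (interp φ (Term.symm m n)) (fun j => if j < m then n + j else j - m) := by
  induction m with
  | zero =>
    rw [Term.symm]
    exact ((isMap_ident n).cast _ _).congr fun j hj => by simp
  | succ m ih =>
    rw [Term.symm]
    have h : IsMap (interp φ (seq (m := m + n + 1)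
        (par (m := 1 + n) (m' := n + 1) (ident m) (symmOne n))
        (par (n := m + n) (n' := n + m) (Term.symm m n) wire))) _ :=
      ((isMap_ident m).directSum (isMap_symmOne n)).comp (ih.directSum (isMap_one 1))
    refine (h.cast _ _).congr fun j hj => ?_
    simp only [id]
    split_ifs <;> omega

lemma ent_one (n i j : ℕ) : ent (.one n) i j = if j < n ∧ i = j then 1 else 0 :=
  (isMap_one n).2 i j

lemma ent_swap (i j : ℕ) : ent .swap i j = if j < 2 ∧ i = 1 - j then 1 else 0 :=
  isMap_swap.2 i j

lemma ent_cop (i j : ℕ) : ent (interpGen .cop) i j = if i < 1 ∧ j < 2 then 1 else 0 := by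
  split_ifs with h
  · obtain ⟨hi, hj⟩ := h
    interval_cases i; interval_cases j <;> simp [ent, interpGen, StochMat.ofNonneg]
  · exact ent_eq_zero _ (by omega)

lemma ent_cc (r : unitInterval) (i j : ℕ) : ent (interpGen (.cc r)) i j =
    if j < 1 then (if i = 0 then (r : ℝ) else if i = 1 then 1 - r else 0) else 0 := by
  by_cases h : i < 2 ∧ j < 1
  · obtain ⟨hi, hj⟩ := h
    interval_cases j; interval_cases i <;> simp [ent, interpGen, StochMat.ofNonneg]
  · rw [ent_eq_zero _ (by omega)]
    split_ifs <;> first | rfl | (exfalso; omega)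

lemma ent_ext_lt {n m : ℕ} {A B : StochMat n m} (h : ∀ i < m, ∀ j < n, ent A i j = ent B i j) :
    A = B := by
  refine ent_ext fun i j => ?_
  by_cases hij : i < m ∧ j < n
  · exact h i hij.1 j hij.2
  · rw [ent_eq_zero A (by omega), ent_eq_zero B (by omega)]

lemma reassocWeight_spec (r u : unitInterval) :
    (1 - (r : ℝ) * u) * reassocWeight r u = r - r * u := by
  unfold reassocWeight
  split_ifs with h
  · have hr0 := r.2.1
    have hr1 := r.2.2
    have hu0 := u.2.1
    have hu1 := u.2.2
    have : (r : ℝ) = 1 := by nlinarith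
    simp only [Set.Icc.coe_one]
    nlinarith
  · have : (1 : ℝ) - r * u ≠ 0 := sub_ne_zero.2 (Ne.symm h)
    field_simp

lemma interp_eq_of_convEq {n m : ℕ} {s t : Term ConvGen n m} (h : ConvEq s t) :
    interp interpGen s = interp interpGen t := by
  induction h with
  | convassoc r u =>
    have e := reassocWeight_spec r u
    refine ent_ext_lt fun i hi j hj => ?_
    interval_cases j
    interval_cases i <;>
    simp [interp, ent_comp, ent_directSum, ent_one, ent_cc, Finset.sum_range_succ] <;> linarith
  | idemp r =>
    refine ent_ext_lt fun i hi j hj => ?_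
    interval_cases j
    interval_cases i
    simp [interp, ent_comp, ent_one, ent_cop, ent_cc, Finset.sum_range_succ]
  | natdel r => exact ent_ext_lt fun i hi j hj => absurd hj (Nat.not_lt_zero j)
  | _ =>
    refine ent_ext_lt fun i hi j hj => ?_
    interval_cases i <;> interval_cases j <;>
    simp [interp, ent_comp, ent_directSum, ent_one, ent_swap, ent_cop, ent_cc,
      Finset.sum_range_succ]

lemma interp_eq_of_provable {T : MonoidalTheory} {ψ : ∀ {n m : ℕ}, T.Gen n m → StochMat n m}
    (hψ : ∀ {n m : ℕ} (s t : Term T.Gen n m), T.eqn s t → interp ψ s = interp ψ t)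
    {n m : ℕ} {s t : Term T.Gen n m} (h : T.Provable s t) : interp ψ s = interp ψ t := by
  induction h with
  | ax h => exact hψ _ _ h
  | refl => rfl
  | symm _ ih => exact ih.symm
  | trans _ _ ih ih' => exact ih.trans ih'
  | seq_congr _ _ ih ih' => rw [interp, interp, ih, ih']
  | par_congr _ _ ih ih' => rw [interp, interp, ih, ih']
  | seq_assoc s t u => exact StochMat.comp_assoc _ _ _
  | par_assoc s t u =>
    refine ent_ext fun i j => ?_
    rw [ent_interp_cast]
    simp only [interp, ent_directSum]
    split_ifs <;> first | rfl | (exfalso; omega) | simp only [Nat.sub_sub]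
  | @interchange n m l n' m' l' s t s' t' =>
    refine ent_ext fun i j => ?_
    simp only [interp, ent_directSum, ent_comp]
    rw [Finset.sum_range_add]
    by_cases hi : i < l <;> by_cases hj : j < n
    · rw [if_pos ⟨hi, hj⟩, Finset.sum_eq_zero (s := Finset.range m'), add_zero]
      · refine Finset.sum_congr rfl fun k hk => ?_
        rw [if_pos ⟨hi, Finset.mem_range.1 hk⟩, if_pos ⟨Finset.mem_range.1 hk, hj⟩]
      · intro k _
        rw [if_neg (by omega), if_neg (by omega), zero_mul]
    · rw [if_neg (by omega), if_neg (by omega), Finset.sum_eq_zero, Finset.sum_eq_zero, add_zero]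
      · intro k _
        rw [if_neg (by omega), if_neg (by omega), zero_mul]
      · intro k hk
        have := Finset.mem_range.1 hk
        rw [if_neg (c := k < m ∧ j < n) (by omega), if_neg (c := m ≤ k ∧ n ≤ j) (by omega),
          mul_zero]
    · rw [if_neg (by omega), if_neg (by omega), Finset.sum_eq_zero, Finset.sum_eq_zero, add_zero]
      · intro k _
        rw [if_neg (c := m + k < m ∧ j < n) (by omega),
          if_neg (c := m ≤ m + k ∧ n ≤ j) (by omega), mul_zero]
      · intro k hk
        have := Finset.mem_range.1 hk
        rw [if_neg (by omega), if_neg (by omega), zero_mul]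
    · rw [if_neg (by omega), if_pos (by omega), Finset.sum_eq_zero (s := Finset.range m), zero_add]
      · refine Finset.sum_congr rfl fun k hk => ?_
        rw [if_neg (by omega), if_pos (by omega), if_neg (by omega), if_pos (by omega),
          Nat.add_sub_cancel_left]
      · intro k hk
        have := Finset.mem_range.1 hk
        rw [if_neg (by omega), if_neg (by omega), zero_mul]
  | empty_par s =>
    refine ent_ext fun i j => ?_
    rw [ent_interp_cast]
    simp [interp, ent_directSum]
  | @par_empty n m s =>
    refine ent_ext fun i j => ?_
    simp only [interp, ent_directSum]
    split_ifs with h h'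
    · rfl
    · rw [ent_eq_zero _ (by omega), ent_eq_zero _ (by omega)]
    · rw [ent_eq_zero _ (by omega)]
  | @ident_seq n m s =>
    have e : interp ψ (ident n) = .one n := (isMap_ident n).eq (isMap_one n)
    exact (congrArg (·.comp (interp ψ s)) e).trans (StochMat.one_comp _)
  | @seq_ident n m s =>
    have e : interp ψ (ident m) = .one m := (isMap_ident m).eq (isMap_one m)
    exact (congrArg ((interp ψ s).comp ·) e).trans (StochMat.comp_one _)
  | @symm_natural n n' m m' s t =>
    have h1 := isMap_symm (φ := ψ) n m
    have h2 := isMap_symm (φ := ψ) n' m'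
    have hf : ∀ j < n' + m', ∀ k < n' + m', (if j < n' then m' + j else j - n') =
        (if k < n' then m' + k else k - n') → j = k := by
      intro j hj k hk
      split_ifs <;> omega
    refine ent_ext_lt fun i hi j hj => ?_
    obtain ⟨k, hk, rfl⟩ : ∃ k < n' + m', (if k < n' then m' + k else k - n') = i := by
      by_cases h : i < m'
      · exact ⟨i + n', by omega, by rw [if_neg (by omega)]; omega⟩
      · exact ⟨i - m', by omega, by rw [if_pos (by omega)]; omega⟩
    rw [interp, interp, h2.ent_comp_right hf _ _ _ hk, h1.ent_comp_left, if_pos hj]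
    rw [interp, interp, ent_directSum, ent_directSum]
    split_ifs <;> first | rfl | (exfalso; omega) | simp only [Nat.add_sub_cancel_left]
  | swap_swap =>
    exact ((isMap_swap.comp isMap_swap).congr fun j hj => by simp only [id]; omega).eq
      (isMap_ident 2)

end

/-- The functor from the syntactic category of convex algebras to stochastic matrices: identity
on objects, and sending (the class of) a term to the matrix it denotes. -/
def fritzFunctor : Syn BarAlg ⥤ FStoch where
  obj n := n
  map {n m} := Quotient.lift (s := BarAlg.setoid n m) (interp interpGen) fun _ _ h =>
    interp_eq_of_provable (fun _ _ h => interp_eq_of_convEq h) h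
  map_id n := (isMap_ident n).eq (isMap_one n)
  map_comp f g := Quotient.inductionOn₂ f g fun _ _ => rfl

end QMon

/-! ### The monoidal category of terms -/

namespace QMon
open Term MonoidalCategory

/-! Algebraic half. Terms modulo provable equality form a symmetric monoidal category `Wires T`. For
convex algebras, the axioms on `del` and `cop` make one wire a commutative monoid, and the axioms on
`del;cc` and `cop;cc` say that every `cc r` is a homomorphism. By induction every morphism is a
homomorphism for the tensor monoid structures (`isMonHom_cls`). Tensor products are therefore
coproducts and the empty object is initial, so a morphism `n → m` is the same as `n` morphisms `1 →
m`, its columns (`eq_copair_incl`, `eq_one_of_zero`).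

The remaining axioms make each hom-set `1 → m` a barycentric algebra, with `x` and `y` mixed by
`choice r ≫ copair x y`. All its elements are convex combinations of the `m` inclusions of a wire
(`exists_isComb_point`). In any barycentric algebra a combination of given elements depends only on
its total weights (`IsComb.unique`): in the cone of weighted elements, a commutative monoid, it
becomes a finite sum. The weights form the column of the matrix and every probability vector occurs,
so the functor is bijective on hom-sets (`mat_injective`, `mat_surjective`).

Metric half. Derivable distances bound `tvmax` by induction on derivations. Conversely, as parallel
composition takes maxima, it suffices to compare single columns. Removing the common part `min p q`
from two distributions gives `p = d x + (1 - d) y` and `q = (1 - d) y + d z` with `d` at most their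
total variation distance (`exists_decomposition`). These two mixtures are the two sides of (TV)
followed by the copairing of `x`, `y`, `z` (`near_mix`). So the functor is isometric, and its
inverse is nonexpansive as well. -/

/-- The objects of the strict monoidal category presented by a monoidal theory. -/
structure Wires (T : MonoidalTheory) where
  num : ℕ

namespace Wires

variable {T : MonoidalTheory}

instance : Category.{0} (Wires T) where
  Hom a b := Quotient (T.setoid a.num b.num)
  id a := Quotient.mk _ (ident a.num)
  comp {a b c} := Quotient.map₂ (sa := T.setoid a.num b.num) (sb := T.setoid b.num c.num)
    (sc := T.setoid a.num c.num) seq (fun _ _ h _ _ h' => .seq_congr h h')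
  id_comp f := Quotient.inductionOn f fun s => Quotient.sound (.ident_seq s)
  comp_id f := Quotient.inductionOn f fun s => Quotient.sound (.seq_ident s)
  assoc f g h := Quotient.inductionOn₃ f g h fun s t u => Quotient.sound (.seq_assoc s t u)

/-- The morphism denoted by a term. -/
def cls {n m : ℕ} (t : Term T.Gen n m) : (⟨n⟩ : Wires T) ⟶ ⟨m⟩ :=
  Quotient.mk (T.setoid n m) t

lemma cls_eq_cls {n m : ℕ} {s t : Term T.Gen n m} : cls s = cls t ↔ T.Provable s t :=
  Quotient.eq (r := T.setoid n m)

lemma cls_surjective {a b : Wires T} (f : a ⟶ b) : ∃ t : Term T.Gen a.num b.num, cls t = f :=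
  Quotient.exists_rep f

lemma cls_seq {n m l : ℕ} (s : Term T.Gen n m) (t : Term T.Gen m l) :
    cls (seq s t) = cls s ≫ cls t := rfl

/-- Casts between arities turn into `eqToHom`, which will serve as the associators and unitors. -/
lemma cls_cast {n n' m m' : ℕ} (hn : n = n') (hm : m = m') (t : Term T.Gen n m) :
    cls (Term.cast hn hm t) =
      eqToHom (congrArg Wires.mk hn.symm) ≫ cls t ≫ eqToHom (congrArg Wires.mk hm) := by
  subst hn hm
  simp [Term.cast]

/-- The parallel composition of morphisms. -/
def par {a a' b b' : Wires T} (f : a ⟶ a') (g : b ⟶ b') :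
    (⟨a.num + b.num⟩ : Wires T) ⟶ ⟨a'.num + b'.num⟩ :=
  Quotient.map₂ (sa := T.setoid _ _) (sb := T.setoid _ _) (sc := T.setoid _ _)
    Term.par (fun _ _ h _ _ h' => .par_congr h h') f g

lemma add_assoc (a b c : Wires T) :
    (⟨a.num + b.num + c.num⟩ : Wires T) = ⟨a.num + (b.num + c.num)⟩ :=
  congrArg Wires.mk (Nat.add_assoc _ _ _)

lemma zero_add (a : Wires T) : (⟨0 + a.num⟩ : Wires T) = a :=
  congrArg Wires.mk (Nat.zero_add _)

lemma par_assoc {a a' b b' c c' : Wires T} (f : a ⟶ a') (g : b ⟶ b') (h : c ⟶ c') :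
    par (par f g) h ≫ eqToHom (add_assoc a' b' c') =
      eqToHom (add_assoc a b c) ≫ par f (par g h) := by
  obtain ⟨f, rfl⟩ := cls_surjective f
  obtain ⟨g, rfl⟩ := cls_surjective g
  obtain ⟨h, rfl⟩ := cls_surjective h
  have e := cls_eq_cls.2 (MonoidalTheory.Provable.par_assoc (T := T) f g h)
  rw [cls_cast] at e
  change cls _ ≫ _ = _ ≫ cls _
  rw [e]
  simp

lemma par_comp {a b c a' b' c' : Wires T} (f : a ⟶ b) (g : b ⟶ c) (f' : a' ⟶ b') (g' : b' ⟶ c') :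
    par (f ≫ g) (f' ≫ g') = par f f' ≫ par g g' := by
  obtain ⟨f, rfl⟩ := cls_surjective f
  obtain ⟨g, rfl⟩ := cls_surjective g
  obtain ⟨f', rfl⟩ := cls_surjective f'
  obtain ⟨g', rfl⟩ := cls_surjective g'
  exact cls_eq_cls.2 (.interchange _ _ _ _)

lemma id_zero_par {a b : Wires T} (f : a ⟶ b) :
    par (𝟙 ⟨0⟩) f ≫ eqToHom (zero_add b) = eqToHom (zero_add a) ≫ f := by
  obtain ⟨f, rfl⟩ := cls_surjective f
  have e := cls_eq_cls.2 (MonoidalTheory.Provable.empty_par (T := T) f)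
  rw [cls_cast] at e
  change cls (Term.par Term.empty f) ≫ _ = _ ≫ cls f
  rw [e]
  simp

lemma par_id_zero {a b : Wires T} (f : a ⟶ b) : par f (𝟙 ⟨0⟩) = f := by
  obtain ⟨f, rfl⟩ := cls_surjective f
  exact cls_eq_cls.2 (.par_empty _)

/-- `ident` adds one wire at a time on the right, and `n + (m + 1)` is `n + m + 1` by definition, so
each inductive step is an instance of associativity with a trivial `eqToHom`. -/
lemma par_id_id (a b : Wires T) : par (𝟙 a) (𝟙 b) = 𝟙 (mk (a.num + b.num)) := by
  obtain ⟨n⟩ := a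
  obtain ⟨m⟩ := b
  induction m with
  | zero => exact par_id_zero _
  | succ m ih =>
    have h := par_assoc (𝟙 (mk n : Wires T)) (𝟙 (mk m)) (cls wire)
    rw [ih] at h
    exact ((Category.id_comp _).symm.trans h.symm).trans (Category.comp_id _)

lemma par_eqToHom {a a' b b' : Wires T} (h : a = a') (h' : b = b') :
    par (eqToHom h) (eqToHom h') = eqToHom (by rw [h, h']) := by
  subst h h'
  exact par_id_id _ _

/-- The category is strict, but the associator and left unitor relate arities that are only
propositionally equal. The right unitor can be the identity because `n + 0` reduces to `n`. -/
instance : MonoidalCategoryStruct (Wires T) where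
  tensorObj a b := ⟨a.num + b.num⟩
  tensorHom f g := par f g
  whiskerLeft a _ _ f := par (𝟙 a) f
  whiskerRight f a := par f (𝟙 a)
  tensorUnit := ⟨0⟩
  associator a b c := eqToIso (add_assoc a b c)
  leftUnitor a := eqToIso (zero_add a)
  rightUnitor a := Iso.refl a

instance : MonoidalCategory (Wires T) := .ofTensorHom
  (id_tensorHom_id := par_id_id)
  (id_tensorHom := fun _ _ _ _ => rfl)
  (tensorHom_id := fun _ _ => rfl)
  (tensorHom_comp_tensorHom := fun f f' g g' => (par_comp f g f' g').symm)
  (associator_naturality := par_assoc)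
  (leftUnitor_naturality := id_zero_par)
  (rightUnitor_naturality := fun f =>
    (Category.comp_id _).trans ((par_id_zero f).trans (Category.id_comp f).symm))
  (pentagon := fun a b c d => by
    change par (eqToHom (add_assoc a b c)) (eqToHom rfl) ≫ eqToHom (add_assoc a ⟨_⟩ d) ≫
      par (eqToHom rfl) (eqToHom (add_assoc b c d)) =
        eqToHom (add_assoc ⟨_⟩ c d) ≫ eqToHom (add_assoc a b ⟨_⟩)
    rw [par_eqToHom, par_eqToHom]
    simp only [eqToHom_trans])
  (triangle := fun a b => by
    change eqToHom (add_assoc a ⟨0⟩ b) ≫ par (eqToHom rfl) (eqToHom (zero_add b)) =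
      par (eqToHom rfl) (eqToHom rfl)
    rw [par_eqToHom, par_eqToHom]
    simp only [eqToHom_trans])

lemma cls_par {n n' m m' : ℕ} (s : Term T.Gen n n') (t : Term T.Gen m m') :
    cls (Term.par s t) = cls s ⊗ₘ cls t := rfl

/-- The identity on one wire is `par empty wire` by definition of `ident`, so this is the left unit
law rather than reflexivity. -/
lemma cls_wire : cls (wire : Term T.Gen 1 1) = 𝟙 (mk 1 : Wires T) := by
  have h := id_zero_par (cls (wire : Term T.Gen 1 1))
  rw [eqToHom_refl, Category.comp_id, Category.id_comp] at h
  exact h.symm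

lemma cls_empty : cls (Term.empty : Term T.Gen 0 0) = 𝟙 (𝟙_ (Wires T)) := rfl

lemma associator_one (a b : Wires T) : (α_ a b (mk 1)).hom = 𝟙 (a ⊗ b ⊗ (mk 1)) := rfl

/-- The symmetry moving one wire past `n` wires. -/
def braidOne (n : ℕ) : (mk 1 : Wires T) ⊗ (mk n) ⟶ (mk n) ⊗ (mk 1) := cls (symmOne n)

/-- The symmetry of `m` and `n` wires. -/
def braid (m n : ℕ) : (mk m : Wires T) ⊗ (mk n) ⟶ (mk n) ⊗ (mk m) := cls (Term.symm m n)

lemma braidOne_zero : braidOne (T := T) 0 = (ρ_ (mk 1)).hom ≫ (λ_ (mk 1)).inv :=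
  cls_wire.trans (Category.id_comp _).symm

/-- The recursion defining `symmOne`, with associators inserted. They are all identities here, but
they bring the formula into a form that makes sense in any monoidal category, where coherence can be
applied. -/
lemma braidOne_succ (n : ℕ) : braidOne (T := T) (n + 1) =
    (α_ (mk 1) (mk n) (mk 1)).inv ≫ braidOne n ▷ (mk 1) ≫ (α_ (mk n) (mk 1) (mk 1)).hom ≫
      (mk n) ◁ cls swap ≫ (α_ (mk n) (mk 1) (mk 1)).inv := by
  have h : braidOne (T := T) (n + 1) = (braidOne n ⊗ₘ cls wire) ≫ ((mk n) ◁ cls swap) := rfl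
  rw [h, cls_wire, tensorHom_id]
  have e1 : (α_ (mk 1 : Wires T) (mk n) (mk 1)).inv = 𝟙 _ := rfl
  have e2 : (α_ (mk n : Wires T) (mk 1) (mk 1)).inv = 𝟙 _ := rfl
  have e3 : (α_ (mk n : Wires T) (mk 1) (mk 1)).hom = 𝟙 _ := rfl
  rw [e1, e2, e3]
  erw [Category.id_comp, Category.id_comp, Category.comp_id]

lemma braid_zero (n : ℕ) : braid (T := T) 0 n = (λ_ (mk n)).hom ≫ (ρ_ (mk n)).inv := by
  have h : braid (T := T) 0 n = cls (cast (Nat.zero_add n).symm rfl (ident n)) := rfl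
  rw [h, cls_cast]
  erw [Category.id_comp]
  rfl

lemma braid_succ (m n : ℕ) : braid (T := T) (m + 1) n =
    (α_ (mk m) (mk 1) (mk n)).hom ≫ (mk m) ◁ braidOne n ≫ (α_ (mk m) (mk n) (mk 1)).inv ≫
      braid m n ▷ (mk 1) ≫ (α_ (mk n) (mk m) (mk 1)).hom := by
  have h : braid (T := T) (m + 1) n = cls (cast (Nat.add_assoc m 1 n).symm rfl
      (seq (m := m + n + 1)
        (Term.par (n := m) (n' := m) (m := 1 + n) (m' := n + 1) (ident m) (symmOne n))
        (Term.par (n := m + n) (n' := n + m) (Term.symm m n) wire))) := rfl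
  rw [h, cls_cast]
  have e : cls (T := T) (seq (m := m + n + 1)
        (Term.par (n := m) (n' := m) (m := 1 + n) (m' := n + 1) (ident m) (symmOne n))
        (Term.par (n := m + n) (n' := n + m) (Term.symm m n) wire)) =
      (CategoryStruct.comp (X := mk m ⊗ mk 1 ⊗ mk n) (Y := (mk m ⊗ mk n) ⊗ mk 1)
        (Z := (mk n ⊗ mk m) ⊗ mk 1) (mk m ◁ braidOne n)
        (braid (T := T) m n ⊗ₘ cls (wire : Term T.Gen 1 1))) := rfl
  rw [e, cls_wire, tensorHom_id]
  have e2 : (α_ (mk m : Wires T) (mk n) (mk 1)).inv = 𝟙 _ := rfl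
  have e3 : (α_ (mk n : Wires T) (mk m) (mk 1)).hom = 𝟙 _ := rfl
  rw [e2, e3]
  erw [Category.id_comp, Category.assoc]
  rfl

end Wires

/-! ### Inductive steps for the hexagon and symmetry laws -/

section Coherence

variable {C : Type*} [Category C] [MonoidalCategory C] {W N N' M M' : C}

/-- This lemma and those after it isolate the steps of the inductions on numbers of wires. The
crossings are arbitrary morphisms, so up to exchange of disjoint boxes and the stated hypotheses
only coherence is used. -/
lemma hexagon_unit_right (f : W ⊗ N ⟶ N ⊗ W) :
    (α_ W N (𝟙_ C)).inv ≫ f ▷ 𝟙_ C ≫ (α_ N W (𝟙_ C)).hom ≫ N ◁ ((ρ_ W).hom ≫ (λ_ W).inv) ≫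
      (α_ N (𝟙_ C) W).inv = W ◁ (ρ_ N).hom ≫ f ≫ (ρ_ N).inv ▷ W := by
  monoidal

lemma hexagon_succ_right (f : W ⊗ N ⟶ N ⊗ W) (g : W ⊗ N' ⟶ N' ⊗ W) (s : W ⊗ W ⟶ W ⊗ W) :
    (α_ W N (N' ⊗ W)).inv ≫ f ▷ (N' ⊗ W) ≫ (α_ N W (N' ⊗ W)).hom ≫
      N ◁ ((α_ W N' W).inv ≫ g ▷ W ≫ (α_ N' W W).hom ≫ N' ◁ s ≫ (α_ N' W W).inv) ≫
      (α_ N (N' ⊗ W) W).inv =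
    W ◁ (α_ N N' W).inv ≫ ((α_ W (N ⊗ N') W).inv ≫
      ((α_ W N N').inv ≫ f ▷ N' ≫ (α_ N W N').hom ≫ N ◁ g ≫ (α_ N N' W).inv) ▷ W ≫
      (α_ (N ⊗ N') W W).hom ≫ (N ⊗ N') ◁ s ≫ (α_ (N ⊗ N') W W).inv) ≫ (α_ N N' W).hom ▷ W := by
  monoidal

lemma hexagon_unit_left (f : M ⊗ N ⟶ N ⊗ M) :
    (α_ M (𝟙_ C) N).hom ≫ M ◁ ((λ_ N).hom ≫ (ρ_ N).inv) ≫ (α_ M N (𝟙_ C)).inv ≫ f ▷ 𝟙_ C ≫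
      (α_ N M (𝟙_ C)).hom = (ρ_ M).hom ▷ N ≫ f ≫ N ◁ (ρ_ M).inv := by
  monoidal

lemma hexagon_succ_left (f : M ⊗ N ⟶ N ⊗ M) (f' : M' ⊗ N ⟶ N ⊗ M') (g : W ⊗ N ⟶ N ⊗ W) :
    (α_ M (M' ⊗ W) N).hom ≫
      M ◁ ((α_ M' W N).hom ≫ M' ◁ g ≫ (α_ M' N W).inv ≫ f' ▷ W ≫ (α_ N M' W).hom) ≫
      (α_ M N (M' ⊗ W)).inv ≫ f ▷ (M' ⊗ W) ≫ (α_ N M (M' ⊗ W)).hom =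
    (α_ M M' W).inv ▷ N ≫ ((α_ (M ⊗ M') W N).hom ≫ (M ⊗ M') ◁ g ≫ (α_ (M ⊗ M') N W).inv ≫
      ((α_ M M' N).hom ≫ M ◁ f' ≫ (α_ M N M').inv ≫ f ▷ M' ≫ (α_ N M M').hom) ▷ W ≫
      (α_ N (M ⊗ M') W).hom) ≫ N ◁ (α_ M M' W).hom := by
  monoidal

lemma hexagon_unit_mid : (λ_ (N ⊗ N')).hom ≫ (ρ_ (N ⊗ N')).inv =
    (α_ (𝟙_ C) N N').inv ≫ ((λ_ N).hom ≫ (ρ_ N).inv) ▷ N' ≫ (α_ N (𝟙_ C) N').hom ≫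
      N ◁ ((λ_ N').hom ≫ (ρ_ N').inv) ≫ (α_ N N' (𝟙_ C)).inv := by
  monoidal

lemma hexagon_succ_mid (f : M ⊗ N ⟶ N ⊗ M) (f' : M ⊗ N' ⟶ N' ⊗ M) (g : W ⊗ N ⟶ N ⊗ W)
    (g' : W ⊗ N' ⟶ N' ⊗ W) :
    (α_ M W (N ⊗ N')).hom ≫
      M ◁ ((α_ W N N').inv ≫ g ▷ N' ≫ (α_ N W N').hom ≫ N ◁ g' ≫ (α_ N N' W).inv) ≫
      (α_ M (N ⊗ N') W).inv ≫
      ((α_ M N N').inv ≫ f ▷ N' ≫ (α_ N M N').hom ≫ N ◁ f' ≫ (α_ N N' M).inv) ▷ W ≫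
      (α_ (N ⊗ N') M W).hom =
    (α_ (M ⊗ W) N N').inv ≫
      ((α_ M W N).hom ≫ M ◁ g ≫ (α_ M N W).inv ≫ f ▷ W ≫ (α_ N M W).hom) ▷ N' ≫
      (α_ N (M ⊗ W) N').hom ≫
      N ◁ ((α_ M W N').hom ≫ M ◁ g' ≫ (α_ M N' W).inv ≫ f' ▷ W ≫ (α_ N' M W).hom) ≫
      (α_ N N' (M ⊗ W)).inv := by
  -- `f` and `g'` act on disjoint tensor factors; sliding one past the other is the only step that
  -- is not pure coherence.
  have e := whisker_exchange f g'
  calc _ = (α_ M W (N ⊗ N')).hom ≫ M ◁ ((α_ W N N').inv ≫ g ▷ N' ≫ (α_ N W N').hom) ≫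
        (α_ M N (W ⊗ N')).inv ≫ ((M ⊗ N) ◁ g' ≫ f ▷ (N' ⊗ W)) ≫ (α_ N M (N' ⊗ W)).hom ≫
        N ◁ ((α_ M N' W).inv ≫ f' ▷ W ≫ (α_ N' M W).hom) ≫ (α_ N N' (M ⊗ W)).inv := by monoidal
    _ = _ := by rw [e]; monoidal

lemma braid_unit_step :
    (α_ M W (𝟙_ C)).hom ≫ M ◁ ((ρ_ W).hom ≫ (λ_ W).inv) ≫ (α_ M (𝟙_ C) W).inv ≫
      ((ρ_ M).hom ≫ (λ_ M).inv) ▷ W ≫ (α_ (𝟙_ C) M W).hom =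
    (ρ_ (M ⊗ W)).hom ≫ (λ_ (M ⊗ W)).inv := by
  monoidal

lemma braidOne_unit_step (s : W ⊗ W ⟶ W ⊗ W) :
    (α_ W (𝟙_ C) W).inv ≫ ((ρ_ W).hom ≫ (λ_ W).inv) ▷ W ≫ (α_ (𝟙_ C) W W).hom ≫ 𝟙_ C ◁ s ≫
      (α_ (𝟙_ C) W W).inv = W ◁ (λ_ W).hom ≫ s ≫ (λ_ W).inv ▷ W := by
  monoidal

lemma symmetry_one_step (f : W ⊗ N ⟶ N ⊗ W) (f' : N ⊗ W ⟶ W ⊗ N) (s : W ⊗ W ⟶ W ⊗ W)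
    (hf : f ≫ f' = 𝟙 _) (hs : s ≫ s = 𝟙 _) :
    ((α_ W N W).inv ≫ f ▷ W ≫ (α_ N W W).hom ≫ N ◁ s ≫ (α_ N W W).inv) ≫
      ((α_ N W W).hom ≫ N ◁ s ≫ (α_ N W W).inv ≫ f' ▷ W ≫ (α_ W N W).hom) = 𝟙 _ := by
  calc _ = (α_ W N W).inv ≫ f ▷ W ≫ (α_ N W W).hom ≫ N ◁ (s ≫ s) ≫ (α_ N W W).inv ≫ f' ▷ W ≫
        (α_ W N W).hom := by monoidal
    _ = (α_ W N W).inv ≫ (f ≫ f') ▷ W ≫ (α_ W N W).hom := by rw [hs]; monoidal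
    _ = _ := by rw [hf]; monoidal

lemma symmetry_step (f : M ⊗ N ⟶ N ⊗ M) (f' : N ⊗ M ⟶ M ⊗ N) (g : W ⊗ N ⟶ N ⊗ W)
    (g' : N ⊗ W ⟶ W ⊗ N) (hf : f ≫ f' = 𝟙 _) (hg : g ≫ g' = 𝟙 _) :
    ((α_ M W N).hom ≫ M ◁ g ≫ (α_ M N W).inv ≫ f ▷ W ≫ (α_ N M W).hom) ≫
      ((α_ N M W).inv ≫ f' ▷ W ≫ (α_ M N W).hom ≫ M ◁ g' ≫ (α_ M W N).inv) = 𝟙 _ := by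
  calc _ = (α_ M W N).hom ≫ M ◁ g ≫ (α_ M N W).inv ≫ (f ≫ f') ▷ W ≫ (α_ M N W).hom ≫ M ◁ g' ≫
        (α_ M W N).inv := by monoidal
    _ = (α_ M W N).hom ≫ M ◁ (g ≫ g') ≫ (α_ M W N).inv := by rw [hf]; simp
    _ = _ := by rw [hg]; monoidal

end Coherence

/-! ### The symmetric structure on wires -/

namespace Wires

variable {T : MonoidalTheory}

/-- Discards the associators and unitors of the coherence lemmas once they are recognised as
identities. -/
lemma eq_of_id_comp_id {a b : Wires T} {f g : a ⟶ b} (h : f = 𝟙 a ≫ g ≫ 𝟙 b) : f = g := by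
  simpa using h

lemma braidOne_one : braidOne (T := T) 1 = cls swap := by
  have h := braidOne_succ (T := T) 0
  rw [braidOne_zero] at h
  have h' := braidOne_unit_step (cls swap : (mk 1 : Wires T) ⊗ mk 1 ⟶ mk 1 ⊗ mk 1)
  have e1 : mk 1 ◁ (λ_ (mk 1 : Wires T)).hom = 𝟙 _ := whiskerLeft_id _ _
  have e2 : (λ_ (mk 1 : Wires T)).inv ▷ mk 1 = 𝟙 _ := id_whiskerRight _ _
  rw [e1, e2] at h'
  exact h.trans (eq_of_id_comp_id h')

/-- The hexagon for a single wire crossing two blocks, by induction on the second block, the side on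
which `symmOne` recurses. -/
lemma braidOne_tensor (n n' : ℕ) : braidOne (T := T) (n + n') =
    (α_ (mk 1) (mk n) (mk n')).inv ≫ braidOne n ▷ mk n' ≫ (α_ (mk n) (mk 1) (mk n')).hom ≫
      mk n ◁ braidOne n' ≫ (α_ (mk n) (mk n') (mk 1)).inv := by
  induction n' with
  | zero =>
    rw [braidOne_zero]
    have h := hexagon_unit_right (braidOne (T := T) n)
    have e1 : mk 1 ◁ (ρ_ (mk n : Wires T)).hom = 𝟙 _ := whiskerLeft_id _ _
    have e2 : (ρ_ (mk n : Wires T)).inv ▷ mk 1 = 𝟙 _ := id_whiskerRight _ _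
    rw [e1, e2] at h
    exact (eq_of_id_comp_id h).symm
  | succ n' ih =>
    have h := hexagon_succ_right (braidOne (T := T) n) (braidOne n') (cls (T := T) swap)
    rw [← braidOne_succ] at h
    have e1 : mk 1 ◁ (α_ (mk n : Wires T) (mk n') (mk 1)).inv = 𝟙 _ := whiskerLeft_id _ _
    have e2 : (α_ (mk n : Wires T) (mk n') (mk 1)).hom ▷ mk 1 = 𝟙 _ := id_whiskerRight _ _
    rw [e1, e2, ← ih] at h
    exact ((eq_of_id_comp_id h).trans (braidOne_succ (n + n')).symm).symm

lemma braid_tensor_left (m m' n : ℕ) : braid (T := T) (m + m') n =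
    (α_ (mk m) (mk m') (mk n)).hom ≫ mk m ◁ braid m' n ≫ (α_ (mk m) (mk n) (mk m')).inv ≫
      braid m n ▷ mk m' ≫ (α_ (mk n) (mk m) (mk m')).hom := by
  induction m' with
  | zero =>
    rw [braid_zero]
    have h := hexagon_unit_left (braid (T := T) m n)
    have e1 : (ρ_ (mk m : Wires T)).hom ▷ mk n = 𝟙 _ := id_whiskerRight _ _
    have e2 : mk n ◁ (ρ_ (mk m : Wires T)).inv = 𝟙 _ := whiskerLeft_id _ _
    rw [e1, e2] at h
    exact (eq_of_id_comp_id h).symm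
  | succ m' ih =>
    have h := hexagon_succ_left (braid (T := T) m n) (braid m' n) (braidOne n)
    rw [← braid_succ] at h
    have e1 : (α_ (mk m : Wires T) (mk m') (mk 1)).inv ▷ mk n = 𝟙 _ := id_whiskerRight _ _
    have e2 : mk n ◁ (α_ (mk m : Wires T) (mk m') (mk 1)).hom = 𝟙 _ := whiskerLeft_id _ _
    rw [e1, e2, ← ih] at h
    exact ((eq_of_id_comp_id h).trans (braid_succ (m + m') n).symm).symm

/-- Induction on `m`: each further wire crosses the two blocks by `braidOne_tensor`, and crossings
of disjoint wires are exchanged. -/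
lemma braid_tensor_right (m n n' : ℕ) : braid (T := T) m (n + n') =
    (α_ (mk m) (mk n) (mk n')).inv ≫ braid m n ▷ mk n' ≫ (α_ (mk n) (mk m) (mk n')).hom ≫
      mk n ◁ braid m n' ≫ (α_ (mk n) (mk n') (mk m)).inv := by
  induction m with
  | zero =>
    rw [braid_zero, braid_zero, braid_zero]
    exact hexagon_unit_mid
  | succ m ih =>
    have h := hexagon_succ_mid (braid (T := T) m n) (braid m n') (braidOne n) (braidOne n')
    rw [← braidOne_tensor, ← ih, ← braid_succ, ← braid_succ] at h
    exact (braid_succ m (n + n')).trans h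

lemma braid_zero_right (m : ℕ) : braid (T := T) m 0 = (ρ_ (mk m)).hom ≫ (λ_ (mk m)).inv := by
  induction m with
  | zero => rw [braid_zero]; rfl
  | succ m ih =>
    have h := braid_succ (T := T) m 0
    rw [ih, braidOne_zero] at h
    exact h.trans braid_unit_step

lemma swap_comp_swap : (cls swap : (mk 1 : Wires T) ⊗ mk 1 ⟶ mk 1 ⊗ mk 1) ≫ cls swap = 𝟙 _ :=
  cls_eq_cls.2 .swap_swap

lemma braidOne_braid (n : ℕ) : braidOne (T := T) n ≫ braid n 1 = 𝟙 _ := by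
  induction n with
  | zero => rw [braid_zero, braidOne_zero]; simp
  | succ n ih =>
    have h := symmetry_one_step (braidOne (T := T) n) (braid n 1) (cls (T := T) swap) ih
      swap_comp_swap
    rw [← braidOne_succ] at h
    rw [braid_succ, braidOne_one]
    exact h

/-- Peeling the last of the `m + 1` wires off both factors leaves two inner pairs of crossings,
which cancel by induction and by `braidOne_braid`; the latter rests on `swap;swap = id`. -/
lemma braid_braid (m n : ℕ) : braid (T := T) m n ≫ braid n m = 𝟙 _ := by
  induction m with
  | zero => rw [braid_zero, braid_zero_right]; simp
  | succ m ih =>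
    have h := symmetry_step (braid (T := T) m n) (braid n m) (braidOne n) (braid n 1) ih
      (braidOne_braid n)
    rw [← braid_tensor_right, ← braid_succ] at h
    exact h

lemma tensorHom_braid {a a' b b' : Wires T} (f : a ⟶ a') (g : b ⟶ b') :
    (f ⊗ₘ g) ≫ braid a'.num b'.num = braid a.num b.num ≫ (g ⊗ₘ f) := by
  obtain ⟨f, rfl⟩ := cls_surjective f
  obtain ⟨g, rfl⟩ := cls_surjective g
  exact cls_eq_cls.2 (.symm_natural f g)

instance : SymmetricCategory (Wires T) where
  braiding a b := ⟨braid a.num b.num, braid b.num a.num, braid_braid _ _, braid_braid _ _⟩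
  braiding_naturality_right a _ _ f := tensorHom_braid (𝟙 a) f
  braiding_naturality_left f a := tensorHom_braid f (𝟙 a)
  hexagon_forward a b c := by
    have h := braid_tensor_right (T := T) a.num b.num c.num
    change (α_ a b c).hom ≫ braid a.num (b.num + c.num) ≫ (α_ b c a).hom = _
    rw [h]
    simp
  hexagon_reverse a b c := by
    have h := braid_tensor_left (T := T) a.num b.num c.num
    change (α_ a b c).inv ≫ braid (a.num + b.num) c.num ≫ (α_ c a b).inv = _
    rw [h]
    simp
  symmetry a b := braid_braid _ _

lemma braiding_one : (β_ (mk 1 : Wires T) (mk 1)).hom = cls swap := by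
  have h := braidOne_braid (T := T) 1
  rw [braidOne_one] at h
  -- `swap` is an involution and `braid 1 1` is also inverse to it, so the two agree.
  calc braid 1 1 = (cls swap ≫ cls swap) ≫ braid (T := T) 1 1 := by
        erw [swap_comp_swap, Category.id_comp]
    _ = cls swap := by rw [Category.assoc, h]; exact Category.comp_id _

end Wires

/-! ### Tensor products of monoids as coproducts -/

section Copairing

open scoped MonObj

variable {C : Type*} [Category C] [MonoidalCategory C] {W X Y Z : C}

/-- The device for comparing monoid structures on one object: structure maps such as associators are
homomorphisms and, in `Wires`, sometimes identities. The unit need not be compared, since the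
multiplication determines it. -/
lemma monObj_eq_of_isMonHom_id (i j : MonObj W) (h : @IsMonHom C _ _ W W i j (𝟙 W)) : i = j := by
  exact MonObj.ext i j (by simpa using h.mul_hom)

/-- The morphism out of a tensor product given by two morphisms into a monoid object. -/
def copair [MonObj Z] (f : X ⟶ Z) (g : Y ⟶ Z) : X ⊗ Y ⟶ Z := (f ⊗ₘ g) ≫ μ[Z]

variable (X Y) in
/-- The first inclusion into a tensor product of monoid objects. -/
def inclLeft [MonObj Y] : X ⟶ X ⊗ Y := (ρ_ X).inv ≫ X ◁ η[Y]

variable (X Y) in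
/-- The second inclusion into a tensor product of monoid objects. -/
def inclRight [MonObj X] : Y ⟶ X ⊗ Y := (λ_ Y).inv ≫ η[X] ▷ Y

/-- The unit inserted by the inclusion is preserved by `g` and then absorbed by the unit law of `Z`.
Only preservation of the unit is needed. -/
lemma inclLeft_copair [MonObj Y] [MonObj Z] (f : X ⟶ Z) (g : Y ⟶ Z) (hg : η ≫ g = η) :
    inclLeft X Y ≫ copair f g = f := by
  have e : X ◁ η[Y] ≫ (f ⊗ₘ g) = (ρ_ X).hom ≫ f ≫ (ρ_ Z).inv ≫ Z ◁ η := by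
    rw [← id_tensorHom, tensorHom_comp_tensorHom, hg, Category.id_comp]
    simp [MonoidalCategory.tensorHom_def]
  simp [inclLeft, copair, reassoc_of% e]

lemma inclRight_copair [MonObj X] [MonObj Z] (f : X ⟶ Z) (g : Y ⟶ Z) (hf : η ≫ f = η) :
    inclRight X Y ≫ copair f g = g := by
  have e : η[X] ▷ Y ≫ (f ⊗ₘ g) = (λ_ Y).hom ≫ g ≫ (λ_ Z).inv ≫ η ▷ Z := by
    rw [← tensorHom_id, tensorHom_comp_tensorHom, hf, Category.id_comp]
    simp [MonoidalCategory.tensorHom_def']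
  simp [inclRight, copair, reassoc_of% e]

lemma copair_comp [MonObj Y] [MonObj W] (f : X ⟶ Y) (g : Z ⟶ Y) (h : Y ⟶ W) [IsMonHom h] :
    copair f g ≫ h = copair (f ≫ h) (g ≫ h) := by
  rw [copair, copair, Category.assoc, IsMonHom.mul_hom, tensorHom_comp_tensorHom_assoc]

lemma tensorHom_copair [MonObj Z] {X' Y' : C} (f : X' ⟶ X) (g : Y' ⟶ Y) (h : X ⟶ Z) (k : Y ⟶ Z) :
    (f ⊗ₘ g) ≫ copair h k = copair (f ≫ h) (g ≫ k) := by
  rw [copair, copair, tensorHom_comp_tensorHom_assoc]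

lemma inclLeft_tensorHom [MonObj Y] {X' Y' : C} [MonObj Y'] (f : X ⟶ X') (g : Y ⟶ Y')
    (hg : η ≫ g = η) : inclLeft X Y ≫ (f ⊗ₘ g) = f ≫ inclLeft X' Y' := by
  have e : X ◁ η[Y] ≫ (f ⊗ₘ g) = (ρ_ X).hom ≫ f ≫ (ρ_ X').inv ≫ X' ◁ η := by
    rw [← id_tensorHom, tensorHom_comp_tensorHom, hg, Category.id_comp]
    simp [MonoidalCategory.tensorHom_def]
  simp [inclLeft, e]

lemma inclRight_tensorHom [MonObj X] {X' Y' : C} [MonObj X'] (f : X ⟶ X') (g : Y ⟶ Y')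
    (hf : η ≫ f = η) : inclRight X Y ≫ (f ⊗ₘ g) = g ≫ inclRight X' Y' := by
  have e : η[X] ▷ Y ≫ (f ⊗ₘ g) = (λ_ Y).hom ≫ g ≫ (λ_ Y').inv ≫ η ▷ Y' := by
    rw [← tensorHom_id, tensorHom_comp_tensorHom, hf, Category.id_comp]
    simp [MonoidalCategory.tensorHom_def']
  simp [inclRight, e]

lemma tensorμ_unit_mid [BraidedCategory C] (X Y : C) :
    ((ρ_ X).inv ⊗ₘ (λ_ Y).inv) ≫ tensorμ X (𝟙_ C) (𝟙_ C) Y = ((ρ_ X).inv ⊗ₘ (λ_ Y).inv) := by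
  have : (β_ (𝟙_ C) (𝟙_ C)).hom = 𝟙 _ := by
    rw [braiding_tensorUnit_left, unitors_equal]; simp
  rw [tensorμ, this]
  monoidal

/-- Rebrackets the middle exchange so that it matches the term `id ⊗ σ ⊗ id` of the axiom `cccop`;
the outer composites are identities in `Wires`. -/
lemma tensorμ_eq [BraidedCategory C] (X : C) : tensorμ X X X X =
    ((α_ X X (X ⊗ X)).hom ≫ X ◁ (α_ X X X).inv ≫ (α_ X (X ⊗ X) X).inv) ≫
      ((𝟙 X ⊗ₘ (β_ X X).hom) ⊗ₘ 𝟙 X) ≫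
      ((α_ X (X ⊗ X) X).hom ≫ X ◁ (α_ X X X).hom ≫ (α_ X X (X ⊗ X)).inv) := by
  rw [tensorμ]
  monoidal

/-- Multiplying `(x, 1)` by `(1, y)` in a product monoid gives `(x, y)`; this is the uniqueness half
of the coproduct property. -/
lemma copair_inclLeft_inclRight [BraidedCategory C] [MonObj X] [MonObj Y] :
    copair (inclLeft X Y) (inclRight X Y) = 𝟙 (X ⊗ Y) := by
  have e : inclLeft X Y ⊗ₘ inclRight X Y =
      ((ρ_ X).inv ⊗ₘ (λ_ Y).inv) ≫ ((𝟙 X ⊗ₘ η) ⊗ₘ (η ⊗ₘ 𝟙 Y)) := by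
    simp only [inclLeft, inclRight, tensorHom_comp_tensorHom, id_tensorHom, tensorHom_id]
  rw [copair, e, MonObj.tensorObj.mul_def, Category.assoc, tensorμ_natural_assoc,
    reassoc_of% tensorμ_unit_mid X Y]
  simp only [tensorHom_comp_tensorHom, id_tensorHom, tensorHom_id, MonObj.mul_one, MonObj.one_mul]
  simp

lemma eq_copair [BraidedCategory C] [MonObj X] [MonObj Y] [MonObj Z] (f : X ⊗ Y ⟶ Z) [IsMonHom f] :
    f = copair (inclLeft X Y ≫ f) (inclRight X Y ≫ f) := by
  rw [← copair_comp, copair_inclLeft_inclRight, Category.id_comp]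

lemma braiding_copair [BraidedCategory C] [MonObj Z] [IsCommMonObj Z] (f : X ⟶ Z) (g : Y ⟶ Z) :
    (β_ Y X).hom ≫ copair f g = copair g f := by
  rw [copair, ← BraidedCategory.braiding_naturality_assoc, IsCommMonObj.mul_comm, copair]

lemma isMonHom_one [MonObj X] : IsMonHom η[X] where
  one_hom := Category.id_comp _
  mul_hom := by
    change (λ_ (𝟙_ C)).hom ≫ η[X] = _
    rw [MonObj.one_mul_hom]

/-- The multiplication of a commutative monoid is a homomorphism by the middle-four exchange, as in
the Eckmann–Hilton argument. -/
lemma isMonHom_mul [BraidedCategory C] [MonObj X] [IsCommMonObj X] : IsMonHom μ[X] where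
  one_hom := by
    rw [MonObj.tensorObj.one_def, Category.assoc, MonObj.one_mul_hom]
    simp
  mul_hom := by
    rw [MonObj.tensorObj.mul_def, Category.assoc, MonObj.mul_mul_mul_comm]

lemma isMonHom_of (i : MonObj X) (j : MonObj Y) (f : X ⟶ Y) (h : i.one ≫ f = j.one)
    (h' : i.mul ≫ f = (f ⊗ₘ f) ≫ j.mul) : IsMonHom f := ⟨h, h'⟩

/-- The monoid structure on a tensor product. -/
@[reducible]
def tensorMonObj [BraidedCategory C] (i : MonObj X) (j : MonObj Y) : MonObj (X ⊗ Y) := inferInstance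

/-- Here and below the monoid structures are explicit arguments, because in `Wires` one object
carries several structures that have yet to be identified. -/
lemma isMonHom_leftUnitor_inv [BraidedCategory C] (i : MonObj X) :
    @IsMonHom C _ _ X (𝟙_ C ⊗ X) i (tensorMonObj inferInstance i) (λ_ X).inv := inferInstance

lemma isMonHom_rightUnitor_inv [BraidedCategory C] (i : MonObj X) :
    @IsMonHom C _ _ X (X ⊗ 𝟙_ C) i (tensorMonObj i inferInstance) (ρ_ X).inv := inferInstance

lemma isMonHom_associator [BraidedCategory C] (i : MonObj X) (j : MonObj Y) (k : MonObj Z) :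
    @IsMonHom C _ _ ((X ⊗ Y) ⊗ Z) (X ⊗ Y ⊗ Z) (tensorMonObj (tensorMonObj i j) k)
      (tensorMonObj i (tensorMonObj j k)) (α_ X Y Z).hom := inferInstance

lemma isMonHom_tensorHom [BraidedCategory C] {X' Y' : C} (i : MonObj X) (j : MonObj Y)
    (i' : MonObj X') (j' : MonObj Y') (f : X ⟶ X') (g : Y ⟶ Y') (hf : IsMonHom f)
    (hg : IsMonHom g) :
    @IsMonHom C _ _ _ _ (tensorMonObj i j) (tensorMonObj i' j') (f ⊗ₘ g) := inferInstance

lemma isMonHom_braiding [SymmetricCategory C] (i : MonObj X) (j : MonObj Y) :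
    @IsMonHom C _ _ _ _ (tensorMonObj i j) (tensorMonObj j i) (β_ X Y).hom := inferInstance

lemma isCommMonObj_tensor [SymmetricCategory C] (i : MonObj X) (j : MonObj Y)
    (hi : IsCommMonObj X) (hj : IsCommMonObj Y) :
    @IsCommMonObj C _ _ _ (X ⊗ Y) (tensorMonObj i j) := inferInstance

end Copairing

/-! ### Every morphism is a monoid homomorphism -/

namespace Wires

open scoped MonObj

/-- The monoid structure on one wire. -/
@[reducible]
def monObjOne : MonObj (mk 1 : Wires ConvAlg) where
  one := cls del
  mul := cls cop
  one_mul := by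
    have h : cls (seq (m := 2) (Term.par del wire) cop) = cls (T := ConvAlg) wire :=
      cls_eq_cls.2 (.ax .unit)
    rw [cls_seq, cls_par, cls_wire, tensorHom_id] at h
    exact h
  mul_one := by
    have h : cls (seq (m := 2) (Term.par del wire) cop) = cls (T := ConvAlg) wire :=
      cls_eq_cls.2 (.ax .unit)
    have h' : cls (seq swap cop) = cls (T := ConvAlg) cop := cls_eq_cls.2 (.ax .comm)
    rw [cls_seq, cls_par, cls_wire, tensorHom_id] at h
    rw [cls_seq, ← braiding_one] at h'
    -- Only the left unit law is an axiom; commutativity moves the unit to the other side.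
    rw [← h', BraidedCategory.braiding_naturality_right_assoc]
    erw [h]
    rw [braiding_tensorUnit_right]
    have e : ((ρ_ (mk 1 : Wires ConvAlg)).hom ≫ (λ_ (mk 1 : Wires ConvAlg)).inv) = 𝟙 _ :=
      Category.id_comp _
    erw [e, Category.id_comp]
    rfl
  mul_assoc := by
    have h : cls (seq (m := 2) (Term.par cop wire) cop) =
      cls (T := ConvAlg) (seq (m := 2) (Term.par wire cop) cop) := cls_eq_cls.2 (.ax .assoc)
    simp only [cls_seq, cls_par, cls_wire, tensorHom_id, id_tensorHom] at h
    exact h.trans (Category.id_comp _).symm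

lemma isCommMonObj_one : @IsCommMonObj (Wires ConvAlg) _ _ _ (mk 1) monObjOne :=
  letI := monObjOne
  { mul_comm := by
      rw [braiding_one]
      exact cls_eq_cls.2 (.ax .comm) }

/-- The monoid structure on `n` wires. -/
@[reducible]
def monObjMk : ∀ n, MonObj (mk n : Wires ConvAlg)
  | 0 => inferInstanceAs (MonObj (𝟙_ (Wires ConvAlg)))
  | n + 1 =>
    tensorMonObj (X := (mk n : Wires ConvAlg)) (Y := mk 1) (monObjMk n) monObjOne

lemma monObjMk_one : monObjMk 1 = monObjOne :=
  (monObj_eq_of_isMonHom_id (C := Wires ConvAlg) (W := mk 1) _ _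
    (isMonHom_leftUnitor_inv (C := Wires ConvAlg) (X := mk 1) monObjOne)).symm

/-- The structure on `n` wires is built one wire at a time, so this rebracketing is an induction on
`m`. The associator used is an identity and a homomorphism, which forces the two structures to
coincide. -/
lemma monObjMk_add (n m : ℕ) : monObjMk (n + m) =
    tensorMonObj (X := (mk n : Wires ConvAlg)) (Y := mk m) (monObjMk n) (monObjMk m) := by
  induction m with
  | zero =>
    exact monObj_eq_of_isMonHom_id (C := Wires ConvAlg) (W := mk n) _ _
      (isMonHom_rightUnitor_inv (C := Wires ConvAlg) (X := mk n) (monObjMk n))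
  | succ m ih =>
    have h : monObjMk (n + (m + 1)) = tensorMonObj (C := Wires ConvAlg) (X := mk (n + m))
      (Y := mk 1) (monObjMk (n + m)) monObjOne := rfl
    rw [h, ih]
    exact monObj_eq_of_isMonHom_id (C := Wires ConvAlg) (W := mk (n + m + 1)) _ _
      (isMonHom_associator (C := Wires ConvAlg) (X := mk n) (Y := mk m) (Z := mk 1) (monObjMk n)
        (monObjMk m) monObjOne)

instance monObj (a : Wires ConvAlg) : MonObj a := monObjMk a.num

lemma monObj_one : monObj (mk 1) = monObjOne := monObjMk_one

lemma monObj_tensor (a b : Wires ConvAlg) : monObj (a ⊗ b) = tensorMonObj (monObj a) (monObj b) :=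
  monObjMk_add a.num b.num

instance isCommMonObj (a : Wires ConvAlg) : IsCommMonObj a := by
  obtain ⟨n⟩ := a
  induction n with
  | zero => exact inferInstanceAs (IsCommMonObj (𝟙_ (Wires ConvAlg)))
  | succ n ih =>
    exact isCommMonObj_tensor (C := Wires ConvAlg) (X := mk n) (Y := mk 1) (monObjMk n)
      monObjOne ih isCommMonObj_one

lemma isMonHom_par {a a' b b' : Wires ConvAlg} (f : a ⟶ a') (g : b ⟶ b') (hf : IsMonHom f)
    (hg : IsMonHom g) :
    @IsMonHom _ _ _ (a ⊗ b) (a' ⊗ b') (monObj _) (monObj _) (f ⊗ₘ g) := by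
  rw [monObj_tensor, monObj_tensor]
  exact isMonHom_tensorHom _ _ _ _ f g hf hg

lemma isMonHom_swap :
    @IsMonHom (Wires ConvAlg) _ _ (mk 1 ⊗ mk 1) (mk 1 ⊗ mk 1) (monObj _) (monObj _) (cls swap) := by
  rw [monObj_tensor]
  rw [← braiding_one]
  exact isMonHom_braiding _ _

/-- The axioms `natdel` and `cccop` are exactly preservation of the unit and of the multiplication.
-/
lemma isMonHom_cc (r : unitInterval) :
    @IsMonHom (Wires ConvAlg) _ _ (mk 1) (mk 1 ⊗ mk 1) (monObj _) (monObj _) (cls (cc r)) := by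
  rw [monObj_tensor, monObj_one]
  refine isMonHom_of (C := Wires ConvAlg) (X := mk 1) (Y := mk 1 ⊗ mk 1) _ _ _ ?_ ?_
  · have h : cls (T := ConvAlg) (seq del (cc r)) =
        cls (T := ConvAlg) (n := 0) (m := 2) (Term.par del del) :=
      cls_eq_cls.2 (.ax (ConvEq.natdel r))
    exact h.trans (Category.id_comp _).symm
  · have h : cls (T := ConvAlg) (seq cop (cc r)) =
        cls (T := ConvAlg) (n := 2) (m := 2) (seq (m := 4) (Term.par (cc r) (cc r))
          (seq (m := 4) (Term.par (Term.par wire Term.swap) wire) (Term.par cop cop))) :=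
      cls_eq_cls.2 (.ax (ConvEq.cccop r))
    have e : tensorμ (mk 1 : Wires ConvAlg) (mk 1) (mk 1) (mk 1) =
        cls (Term.par (Term.par wire Term.swap) wire) := by
      rw [cls_par, cls_par, cls_wire, ← braiding_one]
      have h' := tensorμ_eq (mk 1 : Wires ConvAlg)
      have e1 : mk 1 ◁ (α_ (mk 1 : Wires ConvAlg) (mk 1) (mk 1)).inv = 𝟙 _ := whiskerLeft_id _ _
      have e2 : mk 1 ◁ (α_ (mk 1 : Wires ConvAlg) (mk 1) (mk 1)).hom = 𝟙 _ := whiskerLeft_id _ _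
      have e3 : (α_ (mk 1 : Wires ConvAlg) (mk 1) (mk 1 ⊗ mk 1)).hom ≫ 𝟙 _ ≫
          (α_ (mk 1) (mk 1 ⊗ mk 1) (mk 1)).inv = 𝟙 _ := eq_of_id_comp_id rfl
      have e4 : (α_ (mk 1 : Wires ConvAlg) (mk 1 ⊗ mk 1) (mk 1)).hom ≫ 𝟙 _ ≫
          (α_ (mk 1) (mk 1) (mk 1 ⊗ mk 1)).inv = 𝟙 _ := eq_of_id_comp_id rfl
      rw [e1, e2, e3, e4] at h'
      exact eq_of_id_comp_id h'
    refine h.trans ?_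
    rw [cls_seq, cls_seq, ← e]
    rfl

/-- For `cop` this is commutativity of the monoid, for `cc r` it is `isMonHom_cc`, and homomorphisms
are closed under both compositions. -/
lemma isMonHom_cls {n m : ℕ} (t : Term ConvGen n m) : IsMonHom (cls (T := ConvAlg) t) := by
  induction t with
  | gen g =>
    cases g with
    | del =>
      have h := isMonHom_one (C := Wires ConvAlg) (X := mk 1)
      have e : η[(mk 1 : Wires ConvAlg)] = cls del := by rw [monObj_one]; rfl
      rw [e] at h
      exact h
    | cop =>
      have h : @IsMonHom (Wires ConvAlg) _ _ (mk 1 ⊗ mk 1) (mk 1)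
        (tensorMonObj (monObj _) (monObj _)) _ μ := isMonHom_mul
      have e : μ[(mk 1 : Wires ConvAlg)] = cls cop := by rw [monObj_one]; rfl
      rw [e, ← monObj_tensor] at h
      exact h
    | cc r => exact isMonHom_cc r
  | wire =>
    rw [cls_wire]
    infer_instance
  | empty =>
    rw [cls_empty]
    exact inferInstanceAs (IsMonHom (𝟙 (mk 0 : Wires ConvAlg)))
  | swap => exact isMonHom_swap
  | seq s t hs ht =>
    rw [cls_seq]
    infer_instance
  | par s t hs ht => exact isMonHom_par _ _ hs ht

instance isMonHom {a b : Wires ConvAlg} (f : a ⟶ b) : IsMonHom f := by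
  obtain ⟨t, rfl⟩ := cls_surjective f
  exact isMonHom_cls t

end Wires

/-! ### Barycentric algebras and their cones -/

/-- A convex (barycentric) algebra: binary convex combinations subject to idempotency,
commutativity, associativity and the unit law. -/
class Barycentric (X : Type*) where
  mix : unitInterval → X → X → X
  mix_self : ∀ r x, mix r x x = x
  mix_symm : ∀ r x y, mix (unitInterval.symm r) x y = mix r y x
  mix_mix : ∀ r u x y z, mix r (mix u x y) z = mix (r * u) x (mix (reassocWeight r u) y z)
  mix_zero : ∀ x y, mix 0 x y = y

namespace Barycentric

variable {X : Type*}

variable (X) in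
/-- The positively weighted elements of a convex algebra. -/
def Weighted : Type _ := {r : ℝ // 0 < r} × X

/-- The proportion of `a` in `a + b`. -/
def proportion (a b : {r : ℝ // 0 < r}) : unitInterval :=
  ⟨a / (a + b), div_nonneg a.2.le (add_pos a.2 b.2).le,
    (div_le_one (add_pos a.2 b.2)).2 (by linarith [b.2])⟩

lemma symm_proportion (a b : {r : ℝ // 0 < r}) :
    unitInterval.symm (proportion a b) = proportion b a := by
  ext
  have h := add_pos a.2 b.2
  simp only [unitInterval.coe_symm_eq, proportion, add_comm (b : ℝ) a]
  field_simp
  ring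

lemma proportion_mul_proportion (a b c : {r : ℝ // 0 < r}) :
    proportion (a + b) c * proportion a b = proportion a (b + c) := by
  ext
  have h := add_pos a.2 b.2
  have h' := add_pos h c.2
  simp only [Set.Icc.coe_mul, proportion, Positive.coe_add, ← add_assoc]
  field_simp

/-- The reassociated weight is the share of `b` in what remains after removing `a`. Since all masses
are positive, the exceptional case `0 / 0` never arises. -/
lemma reassocWeight_proportion (a b c : {r : ℝ // 0 < r}) :
    reassocWeight (proportion (a + b) c) (proportion a b) = proportion b c := by
  have ha := a.2
  have hb := b.2
  have hc := c.2
  have e : ((proportion (a + b) c : unitInterval) : ℝ) * proportion a b = a / (a + (b + c)) :=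
    congrArg Subtype.val (proportion_mul_proportion a b c)
  have hne : ((proportion (a + b) c : unitInterval) : ℝ) * proportion a b ≠ 1 := by
    rw [e, Ne, div_eq_one_iff_eq (by positivity)]
    linarith
  have h := reassocWeight_spec (proportion (a + b) c) (proportion a b)
  have h' : (1 : ℝ) - (proportion (a + b) c : unitInterval) * proportion a b ≠ 0 :=
    sub_ne_zero.2 (Ne.symm hne)
  ext
  apply mul_left_cancel₀ h'
  rw [h, e]
  simp only [proportion, Positive.coe_add]
  field_simp
  ring

/-- The element `x` with weight `r` in the cone over a convex algebra. -/
def weigh (r : ℝ) (x : X) : WithZero (Weighted X) :=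
  if h : 0 < r then WithZero.coe (α := Weighted X) (⟨r, h⟩, x) else 0

lemma weigh_zero (x : X) : weigh 0 x = 0 := dif_neg (lt_irrefl _)

lemma weigh_injective {x y : X} (h : weigh 1 x = weigh 1 y) : x = y := by
  rw [weigh, weigh, dif_pos one_pos, dif_pos one_pos] at h
  exact congrArg Prod.snd (WithZero.coe_injective h)

variable [Barycentric X]

/-- Addition pools masses and mixes elements in proportion. Written with masses, the skew laws
`mix_mix` and `mix_symm` become ordinary associativity and commutativity. -/
instance : AddCommSemigroup (Weighted X) where
  add v w := (v.1 + w.1, mix (proportion v.1 w.1) v.2 w.2)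
  add_assoc u v w := by
    refine Prod.ext (add_assoc _ _ _) ?_
    change mix (proportion (u.1 + v.1) w.1) (mix (proportion u.1 v.1) u.2 v.2) w.2 =
      mix (proportion u.1 (v.1 + w.1)) u.2 (mix (proportion v.1 w.1) v.2 w.2)
    rw [mix_mix, proportion_mul_proportion, reassocWeight_proportion]
  add_comm v w := by
    refine Prod.ext (add_comm _ _) ?_
    change mix (proportion v.1 w.1) v.2 w.2 = mix (proportion w.1 v.1) w.2 v.2
    rw [← symm_proportion, mix_symm]

lemma weigh_mix_of_pos {a b : ℝ} (ha : 0 < a) (hb : 0 < b) (x y : X) :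
    weigh (a + b) (mix (proportion ⟨a, ha⟩ ⟨b, hb⟩) x y) = weigh a x + weigh b y := by
  rw [weigh, weigh, weigh, dif_pos ha, dif_pos hb, dif_pos (add_pos ha hb)]
  rfl

/-- Idempotency of mixing is additivity in the mass. -/
lemma weigh_add {a b : ℝ} (ha : 0 ≤ a) (hb : 0 ≤ b) (x : X) :
    weigh (a + b) x = weigh a x + weigh b x := by
  rcases ha.eq_or_lt with rfl | ha
  · rw [weigh_zero, zero_add, zero_add]
  rcases hb.eq_or_lt with rfl | hb
  · rw [weigh_zero, add_zero, add_zero]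
  rw [← weigh_mix_of_pos ha hb, mix_self]

lemma mix_one (x y : X) : mix 1 x y = x := by
  rw [← unitInterval.symm_zero, mix_symm, mix_zero]

lemma weigh_mix {a : ℝ} (ha : 0 ≤ a) (r : unitInterval) (x y : X) :
    weigh a (mix r x y) = weigh (a * r) x + weigh (a * (1 - r)) y := by
  rcases ha.eq_or_lt with rfl | ha
  · simp [weigh_zero]
  -- At the weights 0 and 1 one summand is the adjoined zero, and the unit law of mixing takes over.
  rcases r.2.1.eq_or_lt with h0 | h0
  · obtain rfl : r = 0 := Subtype.ext h0.symm
    simp [weigh_zero, mix_zero]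
  rcases r.2.2.eq_or_lt with h1 | h1
  · obtain rfl : r = 1 := Subtype.ext h1
    simp [weigh_zero, mix_one]
  have hr := mul_pos ha h0
  have hr' := mul_pos ha (sub_pos.2 h1)
  rw [← weigh_mix_of_pos hr hr']
  have e : proportion ⟨_, hr⟩ ⟨_, hr'⟩ = r := by
    ext
    simp only [proportion]
    field_simp
    ring
  rw [e]
  congr 1
  ring

/-- `IsComb e x p` holds if `x` is built by convex combinations from the family `e`, with total
weights `p`. -/
inductive IsComb {k : ℕ} (e : Fin k → X) : X → (Fin k → ℝ) → Prop
  | vertex (i : Fin k) : IsComb e (e i) (Pi.single i 1)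
  | mix (r : unitInterval) {x y : X} {p q : Fin k → ℝ} (hx : IsComb e x p) (hy : IsComb e y q) :
      IsComb e (mix r x y) ((r : ℝ) • p + (1 - (r : ℝ)) • q)

variable {k : ℕ} {e : Fin k → X}

lemma IsComb.nonneg {x : X} {p : Fin k → ℝ} (h : IsComb e x p) (i : Fin k) : 0 ≤ p i := by
  induction h with
  | vertex j => by_cases h : i = j <;> simp [h]
  | mix r _ _ hp hq =>
    exact add_nonneg (mul_nonneg r.2.1 hp) (mul_nonneg (sub_nonneg.2 r.2.2) hq)

/-- The total mass is kept general because the induction passes to the masses `a * r` and `a * (1 -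
r)`. Summands with the same vertex are merged by `weigh_add`. -/
lemma IsComb.weigh_eq {x : X} {p : Fin k → ℝ} (h : IsComb e x p) {a : ℝ} (ha : 0 ≤ a) :
    weigh a x = ∑ i, weigh (a * p i) (e i) := by
  induction h generalizing a with
  | vertex j =>
    rw [Finset.sum_eq_single j]
    · simp
    · intro i _ hi
      simp [hi, weigh_zero]
    · simp
  | mix r hx hy ihx ihy =>
    have hr' : 0 ≤ 1 - (r : ℝ) := sub_nonneg.2 r.2.2
    rw [weigh_mix ha, ihx (mul_nonneg ha r.2.1), ihy (mul_nonneg ha hr'), ← Finset.sum_add_distrib]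
    refine Finset.sum_congr rfl fun i _ => ?_
    rw [← weigh_add (mul_nonneg (mul_nonneg ha r.2.1) (hx.nonneg i))
      (mul_nonneg (mul_nonneg ha hr') (hy.nonneg i))]
    congr 1
    simp only [Pi.add_apply, Pi.smul_apply, smul_eq_mul]
    ring

/-- Convex combinations with equal total weights are equal. -/
lemma IsComb.unique {x y : X} {p : Fin k → ℝ} (hx : IsComb e x p) (hy : IsComb e y p) : x = y :=
  weigh_injective ((hx.weigh_eq zero_le_one).trans (hy.weigh_eq zero_le_one).symm)

/-- Every probability vector is the vector of weights of a convex combination. -/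
lemma exists_isComb (e : Fin k → X) {p : Fin k → ℝ} (hp : p ∈ stdSimplex ℝ (Fin k)) :
    ∃ x, IsComb e x p := by
  rw [← convexHull_basis_eq_stdSimplex] at hp
  -- The simplex is the convex hull of its vertices, and the realised weight vectors contain the
  -- vertices and are closed under mixing.
  refine convexHull_min (t := {p | ∃ x, IsComb e x p}) ?_ ?_ hp
  · rintro _ ⟨i, rfl⟩
    refine ⟨e i, ?_⟩
    convert IsComb.vertex i using 1
    ext j
    simp [Pi.single_apply, eq_comm]
  · rintro p ⟨x, hx⟩ q ⟨y, hy⟩ a b ha hb hab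
    obtain rfl : b = 1 - a := by linarith
    exact ⟨_, hx.mix ⟨a, ha, by linarith⟩ hy⟩

end Barycentric

/-! ### Compatibility of inclusions and copairings with associativity -/

section Inclusions

open scoped MonObj

variable {C : Type*} [Category C] [MonoidalCategory C] {X Y Z : C}

lemma inclLeft_braiding [BraidedCategory C] [MonObj Y] :
    inclLeft X Y ≫ (β_ X Y).hom = inclRight Y X := by
  simp [inclLeft, inclRight]

lemma inclRight_braiding [BraidedCategory C] [MonObj X] :
    inclRight X Y ≫ (β_ X Y).hom = inclLeft Y X := by
  simp [inclLeft, inclRight]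

lemma inclLeft_tensor [BraidedCategory C] (j : MonObj Y) (k : MonObj Z) :
    letI := tensorMonObj j k
    inclLeft X (Y ⊗ Z) = inclLeft X Y ≫ inclLeft (X ⊗ Y) Z ≫ (α_ X Y Z).hom := by
  simp only [inclLeft, MonObj.tensorObj.one_def, MonoidalCategory.tensorHom_def]
  monoidal

lemma inclLeft_inclRight [MonObj X] [MonObj Z] :
    inclLeft Y Z ≫ inclRight X (Y ⊗ Z) = inclRight X Y ≫ inclLeft (X ⊗ Y) Z ≫ (α_ X Y Z).hom := by
  -- The two units are inserted on opposite sides of `Y`, so their order is irrelevant.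
  have h := whisker_exchange η[X] (Y ◁ η[Z])
  have e : inclLeft Y Z ≫ inclRight X (Y ⊗ Z) =
      (ρ_ Y).inv ≫ (λ_ (Y ⊗ 𝟙_ C)).inv ≫ (𝟙_ C ◁ Y ◁ η[Z] ≫ η[X] ▷ (Y ⊗ Z)) := by
    simp [inclLeft, inclRight]
  rw [e, h, inclRight, inclLeft]
  monoidal

lemma inclRight_tensor [BraidedCategory C] (i : MonObj X) (j : MonObj Y) :
    letI := tensorMonObj i j
    inclRight (X ⊗ Y) Z ≫ (α_ X Y Z).hom = inclRight Y Z ≫ inclRight X (Y ⊗ Z) := by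
  simp only [inclRight, MonObj.tensorObj.one_def, MonoidalCategory.tensorHom_def]
  have h := whisker_exchange η[X] (η[Y] ▷ Z)
  have e : ((λ_ Z).inv ≫ η[Y] ▷ Z) ≫ (λ_ (Y ⊗ Z)).inv ≫ η[X] ▷ (Y ⊗ Z) =
      (λ_ Z).inv ≫ (λ_ (𝟙_ C ⊗ Z)).inv ≫ (𝟙_ C ◁ η[Y] ▷ Z ≫ η[X] ▷ (Y ⊗ Z)) := by
    simp
  rw [e, h]
  monoidal

lemma copair_copair [MonObj Z] {W : C} (f : W ⟶ Z) (g : X ⟶ Z) (h : Y ⟶ Z) :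
    copair (copair f g) h = (α_ W X Y).hom ≫ copair f (copair g h) := by
  simp only [copair]
  have e : ((f ⊗ₘ g) ≫ μ) ⊗ₘ h = ((f ⊗ₘ g) ⊗ₘ h) ≫ μ ▷ Z := by
    rw [← tensorHom_id, tensorHom_comp_tensorHom, Category.comp_id]
  have e' : f ⊗ₘ ((g ⊗ₘ h) ≫ μ) = (f ⊗ₘ (g ⊗ₘ h)) ≫ Z ◁ μ := by
    rw [← id_tensorHom, tensorHom_comp_tensorHom, Category.comp_id]
  rw [e, e', Category.assoc, MonObj.mul_assoc, Category.assoc, associator_naturality_assoc]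

lemma copair_one [MonObj Z] (f : X ⟶ Z) : copair f η[Z] = (ρ_ X).hom ≫ f := by
  rw [copair, MonObj.mul_one_hom]

lemma one_copair [MonObj Z] (f : X ⟶ Z) : copair η[Z] f = (λ_ X).hom ≫ f := by
  rw [copair, MonObj.one_mul_hom]

end Inclusions

/-! ### Morphisms out of one wire as convex combinations -/

namespace Wires

open scoped MonObj
open Barycentric

lemma eq_copair_incl {a b c : Wires ConvAlg} (f : a ⊗ b ⟶ c) :
    f = copair (inclLeft a b ≫ f) (inclRight a b ≫ f) := by
  have h : @IsMonHom _ _ _ (a ⊗ b) c (tensorMonObj (monObj a) (monObj b)) (monObj c) f := by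
    rw [← monObj_tensor]
    exact isMonHom f
  exact eq_copair f

/-- The unit on zero wires is the identity and every morphism preserves units, so zero wires form an
initial object. -/
lemma eq_one_of_zero {b : Wires ConvAlg} (f : mk 0 ⟶ b) : f = η[b] := by
  have h : η[(mk 0 : Wires ConvAlg)] ≫ f = η[b] := IsMonHom.one_hom f
  exact (Category.id_comp f).symm.trans h

/-- The class of the generator `cc r`. -/
def choice (r : unitInterval) : (mk 1 : Wires ConvAlg) ⟶ mk 1 ⊗ mk 1 := cls (cc r)

/-- Each law is one axiom on `cc` followed by a property of copairing: `x` preserves multiplication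
(idempotency), `b` is commutative (symmetry), copairing is associative, and `x` preserves the unit
(weight zero). -/
instance (b : Wires ConvAlg) : Barycentric (mk 1 ⟶ b) where
  mix r x y := choice r ≫ copair x y
  mix_self r x := by
    have h : choice r ≫ cls cop = 𝟙 _ := (cls_eq_cls.2 (.ax (ConvEq.idemp r))).trans cls_wire
    have e : copair x x = cls cop ≫ x := by
      have h' := IsMonHom.mul_hom x
      rw [monObj_one] at h'
      exact h'.symm
    rw [e, reassoc_of% h]
  mix_symm r x y := by
    have h : choice r ≫ (β_ _ _).hom = choice (unitInterval.symm r) := by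
      rw [braiding_one]
      exact cls_eq_cls.2 (.ax (ConvEq.convcomm r))
    rw [← h, Category.assoc, braiding_copair]
  mix_mix r u x y z := by
    have h : choice r ≫ choice u ▷ mk 1 ≫ (α_ _ _ _).hom =
        choice (r * u) ≫ mk 1 ◁ choice (reassocWeight r u) := by
      have h' : cls (T := ConvAlg) (n := 1) (m := 3) (seq (m := 2) (cc r) (Term.par (cc u) wire)) =
          cls (seq (m := 2) (cc (r * u)) (Term.par wire (cc (reassocWeight r u)))) :=
        cls_eq_cls.2 (.ax (ConvEq.convassoc r u))
      rw [cls_seq, cls_seq, cls_par, cls_par, cls_wire, tensorHom_id, id_tensorHom] at h'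
      refine Eq.trans ?_ h'
      exact congrArg (choice r ≫ ·) (Category.comp_id (choice u ▷ mk 1))
    have e1 : copair (choice u ≫ copair x y) z = choice u ▷ mk 1 ≫ copair (copair x y) z := by
      rw [← tensorHom_id, tensorHom_copair, Category.id_comp]
    have e2 : copair x (choice (reassocWeight r u) ≫ copair y z) =
        mk 1 ◁ choice (reassocWeight r u) ≫ copair x (copair y z) := by
      rw [← id_tensorHom, tensorHom_copair, Category.id_comp]
    rw [e1, e2, copair_copair, reassoc_of% h]
  mix_zero x y := by
    have h : choice 0 = inclRight (mk 1) (mk 1) := by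
      have h' : cls (T := ConvAlg) (n := 1) (m := 2) (cc 0) = cls (Term.par del wire) :=
        cls_eq_cls.2 (.ax .zprob)
      rw [cls_par, cls_wire, tensorHom_id] at h'
      rw [inclRight, monObj_one]
      exact h'.trans (Category.id_comp _).symm
    rw [h, inclRight_copair _ _ (IsMonHom.one_hom _)]

lemma mix_comp {b c : Wires ConvAlg} (r : unitInterval) (x y : mk 1 ⟶ b) (f : b ⟶ c) :
    mix r x y ≫ f = mix r (x ≫ f) (y ≫ f) := by
  change (choice r ≫ copair x y) ≫ f = choice r ≫ copair _ _
  rw [Category.assoc, copair_comp]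

/-- The inclusion of the wire `i` into `n` wires. -/
def point : (n : ℕ) → Fin n → ((mk 1 : Wires ConvAlg) ⟶ mk n)
  | 0 => Fin.elim0
  | n + 1 => Fin.lastCases (inclRight (mk n) (mk 1)) fun i => point n i ≫ inclLeft (mk n) (mk 1)

lemma point_last (n : ℕ) : point (n + 1) (Fin.last n) = inclRight (mk n) (mk 1) := by
  simp only [point, Fin.lastCases_last]

lemma point_castSucc (n : ℕ) (i : Fin n) :
    point (n + 1) i.castSucc = point n i ≫ inclLeft (mk n) (mk 1) := by
  simp only [point, Fin.lastCases_castSucc]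

lemma point_one : point 1 0 = 𝟙 (mk 1) := by
  refine (point_last 0).trans ?_
  rw [inclRight, show η[(mk 0 : Wires ConvAlg)] = 𝟙 _ from rfl, id_whiskerRight]
  exact Category.id_comp _

lemma inclLeft_add (n m : ℕ) : inclLeft (mk n : Wires ConvAlg) (mk (m + 1)) =
    inclLeft (mk n) (mk m) ≫ inclLeft (mk (n + m)) (mk 1) := by
  have h := inclLeft_tensor (C := Wires ConvAlg) (X := mk n) (monObj (mk m)) (monObj (mk 1))
  rw [← monObj_tensor] at h
  refine h.trans ?_
  rw [associator_one, ← Category.assoc]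
  exact Category.comp_id _

lemma inclRight_add (n m : ℕ) : inclRight (mk (n + m) : Wires ConvAlg) (mk 1) =
    inclRight (mk m) (mk 1) ≫ inclRight (mk n) (mk (m + 1)) := by
  have h := inclRight_tensor (C := Wires ConvAlg) (Z := mk 1) (monObj (mk n)) (monObj (mk m))
  rw [← monObj_tensor] at h
  refine Eq.trans ?_ h
  rw [associator_one]
  exact (Category.comp_id _).symm

lemma inclLeft_comp_inclRight (n m : ℕ) :
    inclLeft (mk m : Wires ConvAlg) (mk 1) ≫ inclRight (mk n) (mk (m + 1)) =
      inclRight (mk n) (mk m) ≫ inclLeft (mk (n + m)) (mk 1) := by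
  have h := inclLeft_inclRight (C := Wires ConvAlg) (X := mk n) (Y := mk m) (Z := mk 1)
  refine h.trans ?_
  rw [associator_one, ← Category.assoc]
  exact Category.comp_id _

lemma point_castAdd (n m : ℕ) (i : Fin n) :
    point (n + m) (i.castAdd m) = point n i ≫ inclLeft (mk n) (mk m) := by
  induction m with
  | zero =>
    rw [inclLeft, show η[(mk 0 : Wires ConvAlg)] = 𝟙 _ from rfl, whiskerLeft_id]
    exact (Category.comp_id (point n i)).symm.trans
      (congrArg (point n i ≫ ·) (Category.comp_id (𝟙 (mk n))).symm)
  | succ m ih =>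
    rw [inclLeft_add, ← Category.assoc, ← ih]
    exact point_castSucc (n + m) (i.castAdd m)

lemma point_natAdd (n m : ℕ) (i : Fin m) :
    point (n + m) (i.natAdd n) = point m i ≫ inclRight (mk n) (mk m) := by
  induction m with
  | zero => exact i.elim0
  | succ m ih =>
    refine Fin.lastCases ?_ (fun i => ?_) i
    · rw [point_last, ← inclRight_add]
      exact point_last (n + m)
    · rw [point_castSucc, Category.assoc, inclLeft_comp_inclRight, ← Category.assoc, ← ih]
      exact point_castSucc (n + m) (i.natAdd n)

/-- Postcomposition is affine by `mix_comp`, so it is enough to know the images of the points. -/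
lemma _root_.QMon.Barycentric.IsComb.comp {n m : ℕ} {f : (mk n : Wires ConvAlg) ⟶ mk m}
    (hf : ∀ i, ∃ p, IsComb (point m) (point n i ≫ f) p) {x : mk 1 ⟶ mk n} {p : Fin n → ℝ}
    (hx : IsComb (point n) x p) : ∃ q, IsComb (point m) (x ≫ f) q := by
  induction hx with
  | vertex i => exact hf i
  | mix r _ _ hx hy =>
    obtain ⟨p, hp⟩ := hx
    obtain ⟨q, hq⟩ := hy
    rw [mix_comp]
    exact ⟨_, hp.mix r hq⟩

lemma point_two_zero : point 2 0 = inclLeft (mk 1) (mk 1) := by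
  refine (point_castSucc 1 0).trans ?_
  rw [point_one, Category.id_comp]

lemma point_two_one : point 2 1 = inclRight (mk 1) (mk 1) := point_last 1

lemma exists_isComb_of_eq_point {m : ℕ} {x : mk 1 ⟶ mk m} {i : Fin m} (h : x = point m i) :
    ∃ p, IsComb (point m) x p := by
  subst h
  exact ⟨_, .vertex i⟩

lemma exists_isComb_point_comp {n m : ℕ} (t : Term ConvGen n m) (i : Fin n) :
    ∃ p, IsComb (point m) (point n i ≫ cls t) p := by
  induction t with
  | gen g =>
    cases g with
    | del => exact i.elim0
    | cop =>
      have e : cls (T := ConvAlg) cop = copair (𝟙 (mk 1)) (𝟙 (mk 1)) := by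
        rw [copair, id_tensorHom_id, monObj_one]
        exact (Category.id_comp _).symm
      have h : point 2 i ≫ cls (T := ConvAlg) cop = point 1 0 := by
        rw [e, point_one]
        fin_cases i
        · exact (congrArg (· ≫ _) point_two_zero).trans
            (inclLeft_copair _ _ (IsMonHom.one_hom _))
        · exact (congrArg (· ≫ _) point_two_one).trans
            (inclRight_copair _ _ (IsMonHom.one_hom _))
      exact exists_isComb_of_eq_point h
    | cc r =>
      have e : point 1 i ≫ cls (T := ConvAlg) (cc r) = mix r (point 2 0) (point 2 1) := by
        obtain rfl : i = 0 := Subsingleton.elim _ _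
        rw [point_one, point_two_zero, point_two_one]
        refine (Category.id_comp _).trans ?_
        -- The identity is the copairing of the two inclusions, so `cc r` itself is their mixture.
        have h : 𝟙 ((mk 1 : Wires ConvAlg) ⊗ mk 1) =
            copair (inclLeft (mk 1) (mk 1)) (inclRight (mk 1) (mk 1)) := by
          have := eq_copair_incl (𝟙 ((mk 1 : Wires ConvAlg) ⊗ mk 1))
          rwa [Category.comp_id, Category.comp_id] at this
        exact (Category.comp_id (choice r)).symm.trans (congrArg (choice r ≫ ·) h)
      exact ⟨_, e ▸ IsComb.mix r (IsComb.vertex 0) (IsComb.vertex 1)⟩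
  | wire =>
    rw [cls_wire, Category.comp_id]
    exact ⟨_, .vertex i⟩
  | empty => exact i.elim0
  | swap =>
    fin_cases i
    · have h : point 2 0 ≫ cls (T := ConvAlg) Term.swap = point 2 1 := by
        rw [point_two_zero, point_two_one, ← inclLeft_braiding, braiding_one]
      exact exists_isComb_of_eq_point h
    · have h : point 2 1 ≫ cls (T := ConvAlg) Term.swap = point 2 0 := by
        rw [point_two_zero, point_two_one, ← inclRight_braiding, braiding_one]
      exact exists_isComb_of_eq_point h
  | seq s t hs ht =>
    obtain ⟨p, hp⟩ := hs i
    rw [cls_seq, ← Category.assoc]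
    exact hp.comp ht
  | @par n n' m m' s t hs ht =>
    rw [cls_par]
    -- An input wire lies in one of the two blocks; the inclusion of that block slides past the
    -- parallel composite, and it sends points to points.
    refine Fin.addCases (fun i => ?_) (fun i => ?_) i
    · obtain ⟨p, hp⟩ := hs i
      rw [point_castAdd, Category.assoc, inclLeft_tensorHom _ _ (IsMonHom.one_hom _),
        ← Category.assoc]
      exact hp.comp fun i => exists_isComb_of_eq_point (point_castAdd n' m' i).symm
    · obtain ⟨p, hp⟩ := ht i
      rw [point_natAdd, Category.assoc, inclRight_tensorHom _ _ (IsMonHom.one_hom _),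
        ← Category.assoc]
      exact hp.comp fun i => exists_isComb_of_eq_point (point_natAdd n' m' i).symm

/-- Every morphism out of one wire is a convex combination of points. -/
lemma exists_isComb_point {m : ℕ} (x : (mk 1 : Wires ConvAlg) ⟶ mk m) :
    ∃ p, IsComb (point m) x p := by
  obtain ⟨t, rfl⟩ := cls_surjective x
  have h := exists_isComb_point_comp t 0
  rw [point_one] at h
  erw [Category.id_comp] at h
  exact h

end Wires

/-! ### Matrices determine morphisms -/

namespace Wires

open scoped MonObj
open Barycentric

/-- The stochastic matrix of a morphism. -/
def mat {a b : Wires ConvAlg} (f : a ⟶ b) : StochMat a.num b.num :=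
  Quotient.lift (s := ConvAlg.setoid a.num b.num) (interp interpGen) (fun _ _ h =>
    interp_eq_of_provable (fun _ _ h => interp_eq_of_convEq h) h) f

lemma mat_comp {a b c : Wires ConvAlg} (f : a ⟶ b) (g : b ⟶ c) :
    mat (f ≫ g) = (mat f).comp (mat g) := by
  obtain ⟨s, rfl⟩ := cls_surjective f
  obtain ⟨t, rfl⟩ := cls_surjective g
  rfl

lemma mat_tensorHom {a a' b b' : Wires ConvAlg} (f : a ⟶ a') (g : b ⟶ b') :
    mat (f ⊗ₘ g) = (mat f).directSum (mat g) := by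
  obtain ⟨s, rfl⟩ := cls_surjective f
  obtain ⟨t, rfl⟩ := cls_surjective g
  rfl

lemma isMap_id (a : Wires ConvAlg) : IsMap (mat (𝟙 a)) id := isMap_ident a.num

lemma isMap_eqToHom {a b : Wires ConvAlg} (h : a = b) : IsMap (mat (eqToHom h)) id := by
  subst h
  exact isMap_id a

lemma isMap_of_zero {b : Wires ConvAlg} (f : 𝟙_ (Wires ConvAlg) ⟶ b) (φ : ℕ → ℕ) :
    IsMap (mat f) φ := by
  refine ⟨fun j hj => absurd hj (Nat.not_lt_zero j), fun i j => ?_⟩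
  rw [ent_eq_zero _ (Or.inr (Nat.zero_le j)), if_neg]
  exact fun h => Nat.not_lt_zero j h.1

lemma isMap_inclLeft (a b : Wires ConvAlg) : IsMap (mat (inclLeft a b)) id := by
  have h := ((isMap_id a).directSum (isMap_of_zero η[b] id))
  rw [← mat_tensorHom, id_tensorHom] at h
  have h' := (isMap_id a).comp h
  have e : inclLeft a b = 𝟙 a ≫ a ◁ η[b] := rfl
  rw [e, mat_comp]
  refine h'.congr fun j hj => ?_
  simp only [id, if_pos hj]

lemma isMap_inclRight (a b : Wires ConvAlg) : IsMap (mat (inclRight a b)) (a.num + ·) := by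
  have h := ((isMap_of_zero η[a] id).directSum (isMap_id b))
  rw [← mat_tensorHom, tensorHom_id] at h
  have h' := (isMap_eqToHom (zero_add b).symm).comp h
  have e : inclRight a b = eqToHom (zero_add b).symm ≫ η[a] ▷ b := rfl
  rw [e, mat_comp]
  refine h'.congr fun j hj => ?_
  change (if j < 0 then j else a.num + (j - 0)) = a.num + j
  rw [if_neg (Nat.not_lt_zero j), Nat.sub_zero]

/-- The inclusions denote column selections, so precomposing with them reads off the two blocks of
columns. -/
lemma ent_copair {a b c : Wires ConvAlg} (f : a ⟶ c) (g : b ⟶ c) (i j : ℕ) :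
    ent (mat (copair f g)) i j = if j < a.num then ent (mat f) i j
      else ent (mat g) i (j - a.num) := by
  have hf := (isMap_inclLeft a b).ent_comp_left (mat (copair f g)) i j
  have hg := (isMap_inclRight a b).ent_comp_left (mat (copair f g)) i (j - a.num)
  rw [← mat_comp, inclLeft_copair _ _ (IsMonHom.one_hom _)] at hf
  rw [← mat_comp, inclRight_copair _ _ (IsMonHom.one_hom _)] at hg
  split_ifs with h
  · rw [hf, if_pos h, id]
  · rw [hg]
    by_cases h' : j - a.num < b.num
    · rw [if_pos h', Nat.add_sub_cancel' (not_lt.1 h)]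
    · rw [if_neg h']
      refine ent_eq_zero _ (Or.inr ?_)
      change a.num + b.num ≤ j
      omega

lemma isMap_point (n : ℕ) (i : Fin n) : IsMap (mat (point n i)) (fun _ => i) := by
  induction n with
  | zero => exact i.elim0
  | succ n ih =>
    refine Fin.lastCases ?_ (fun i => ?_) i
    · rw [point_last]
      refine (isMap_inclRight (mk n) (mk 1)).congr fun j hj => ?_
      change j < 1 at hj
      simp only [Fin.val_last]
      omega
    · rw [point_castSucc, mat_comp]
      exact (ih i).comp (isMap_inclLeft (mk n) (mk 1))

/-- The first column of the matrix of a morphism. -/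
def weights {m : ℕ} (x : (mk 1 : Wires ConvAlg) ⟶ mk m) (i : Fin m) : ℝ := (mat x).mat i 0

lemma weights_eq_ent {m : ℕ} (x : (mk 1 : Wires ConvAlg) ⟶ mk m) (i : Fin m) :
    weights x i = ent (mat x) i 0 := by
  rw [ent, dif_pos ⟨i.2, Nat.one_pos⟩]
  rfl

lemma ent_choice (r : unitInterval) (i j : ℕ) : ent (mat (choice r)) i j =
    if j < 1 then (if i = 0 then (r : ℝ) else if i = 1 then 1 - r else 0) else 0 :=
  ent_cc r i j

lemma weights_mix {m : ℕ} (r : unitInterval) (x y : (mk 1 : Wires ConvAlg) ⟶ mk m) :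
    weights (mix r x y) = (r : ℝ) • weights x + (1 - (r : ℝ)) • weights y := by
  ext i
  change weights (choice r ≫ copair x y) i = r * weights x i + (1 - r) * weights y i
  simp only [weights_eq_ent]
  rw [mat_comp, ent_comp]
  change ∑ k ∈ Finset.range 2, _ = _
  simp [Finset.sum_range_succ, ent_copair, ent_choice]
  ring

lemma weights_point (m : ℕ) (i : Fin m) : weights (point m i) = Pi.single i 1 := by
  ext j
  rw [weights_eq_ent, (isMap_point m i).2, Pi.single_apply]
  simp [Fin.ext_iff]

/-- The formal weights of a combination of points are visible in its matrix; with `IsComb.unique`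
this gives faithfulness on one wire. -/
lemma _root_.QMon.Barycentric.IsComb.weights_eq {m : ℕ} {x : (mk 1 : Wires ConvAlg) ⟶ mk m}
    {p : Fin m → ℝ} (h : IsComb (point m) x p) : weights x = p := by
  induction h with
  | vertex i => exact weights_point m i
  | mix r _ _ hp hq => rw [weights_mix, hp, hq]

lemma isComb_weights {m : ℕ} (x : (mk 1 : Wires ConvAlg) ⟶ mk m) :
    IsComb (point m) x (weights x) := by
  obtain ⟨p, hp⟩ := exists_isComb_point x
  rwa [hp.weights_eq]

lemma weights_injective {m : ℕ} {x y : (mk 1 : Wires ConvAlg) ⟶ mk m}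
    (h : weights x = weights y) : x = y :=
  (isComb_weights x).unique (h ▸ isComb_weights y)

lemma exists_weights_eq {m : ℕ} {p : Fin m → ℝ} (hp : p ∈ stdSimplex ℝ (Fin m)) :
    ∃ x : (mk 1 : Wires ConvAlg) ⟶ mk m, weights x = p :=
  (exists_isComb (point m) hp).imp fun _ h => h.weights_eq

lemma weights_mem {m : ℕ} (x : (mk 1 : Wires ConvAlg) ⟶ mk m) :
    weights x ∈ stdSimplex ℝ (Fin m) :=
  ⟨fun i => ((mat x).mem_Icc i 0).1, (mat x).sum_col 0⟩

/-- Morphisms with equal matrices are equal. -/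
lemma mat_injective {a b : Wires ConvAlg} {f g : a ⟶ b} (h : mat f = mat g) : f = g := by
  obtain ⟨n⟩ := a
  induction n with
  | zero => exact (eq_one_of_zero f).trans (eq_one_of_zero g).symm
  | succ n ih =>
    have hf := eq_copair_incl (a := mk n) (b := mk 1) f
    have hg := eq_copair_incl (a := mk n) (b := mk 1) g
    rw [hf, hg]
    -- The first `n` columns agree by induction; the last column is a morphism out of one wire,
    -- determined by its weights.
    congr 1
    · exact ih ((mat_comp _ _).trans ((congrArg _ h).trans (mat_comp _ _).symm))
    · exact weights_injective (m := b.num) (congrArg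
        (fun A : StochMat 1 b.num => fun i => A.mat i 0)
        ((mat_comp _ _).trans ((congrArg _ h).trans (mat_comp _ _).symm)))

/-- Every stochastic matrix is the matrix of a morphism. -/
lemma mat_surjective {n m : ℕ} (A : StochMat n m) :
    ∃ f : (mk n : Wires ConvAlg) ⟶ mk m, mat f = A := by
  induction n with
  | zero => exact ⟨η[mk m], ent_ext_lt fun i _ j hj => absurd hj (Nat.not_lt_zero j)⟩
  | succ n ih =>
    obtain ⟨f, hf⟩ := ih (.ofNonneg (fun i j => A.mat i j.castSucc) (fun i j => (A.mem_Icc _ _).1)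
      fun j => A.sum_col _)
    obtain ⟨x, hx⟩ := exists_weights_eq (p := fun i => A.mat i (Fin.last n))
      ⟨fun i => (A.mem_Icc _ _).1, A.sum_col _⟩
    refine ⟨copair f x, ent_ext_lt fun i hi j hj => ?_⟩
    change i < m at hi
    change j < n + 1 at hj
    refine (ent_copair f x i j).trans ?_
    change (if j < n then _ else ent (mat x) i (j - n)) = _
    split_ifs with h
    · rw [hf]
      simp [ent, hi, hj, h, StochMat.ofNonneg]
    · obtain rfl : j = n := by omega
      rw [Nat.sub_self, ← weights_eq_ent x ⟨i, hi⟩, hx]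
      simp [ent, hi, Fin.last]

end Wires

/-! ### Soundness of derivable distances -/

lemma le_tv {m : ℕ} (p q : Fin m → ℝ) (S : Finset (Fin m)) :
    ENNReal.ofReal |∑ i ∈ S, p i - ∑ i ∈ S, q i| ≤ tv p q :=
  le_iSup (fun S : Finset (Fin m) => ENNReal.ofReal |∑ i ∈ S, p i - ∑ i ∈ S, q i|) S

lemma tv_le_tvmax {n m : ℕ} (A B : StochMat n m) (j : Fin n) :
    tv (fun i => A.mat i j) (fun i => B.mat i j) ≤ tvmax A B :=
  le_iSup (fun j => tv (fun i => A.mat i j) (fun i => B.mat i j)) j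

/-- Each column of a direct sum is supported in one block, so an event matters only through its
trace on that block. This is why parallel composition takes the maximum and not the sum. -/
lemma tvmax_directSum_le {n n' m m' : ℕ} (A A' : StochMat n n') (B B' : StochMat m m') :
    tvmax (A.directSum B) (A'.directSum B') ≤ max (tvmax A A') (tvmax B B') := by
  refine iSup_le fun j => iSup_le fun S => ?_
  have hS : ∀ f : Fin (n' + m') → ℝ, ∑ i ∈ S, f i =
      ∑ i with Fin.castAdd m' i ∈ S, f (Fin.castAdd m' i) +
        ∑ i with Fin.natAdd n' i ∈ S, f (Fin.natAdd n' i) := by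
    intro f
    rw [Finset.sum_filter, Finset.sum_filter, 
      ← Fin.sum_univ_add (fun i => if i ∈ S then f i else 0), Finset.sum_ite_mem, Finset.univ_inter]
  refine Fin.addCases (fun j => ?_) (fun j => ?_) j
  · refine le_max_of_le_left (le_trans ?_ (tv_le_tvmax A A' j))
    rw [hS, hS]
    simpa [StochMat.directSum, StochMat.ofNonneg] using
      le_tv (fun i => A.mat i j) (fun i => A'.mat i j) {i | Fin.castAdd m' i ∈ S}
  · refine le_max_of_le_right (le_trans ?_ (tv_le_tvmax B B' j))
    rw [hS, hS]
    simpa [StochMat.directSum, StochMat.ofNonneg] using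
      le_tv (fun i => B.mat i j) (fun i => B'.mat i j) {i | Fin.natAdd n' i ∈ S}

/-- The two columns are `(r, 1 - r, 0)` and `(0, 1 - r, r)`. They differ by `(r, 0, -r)`, so each
event changes its probability by `r`, `0` or `-r`. -/
lemma tvmax_le_of_tvEq {n m : ℕ} {s t : Term ConvGen n m} {ε : ℝ≥0∞} (h : TVEq s t ε) :
    tvmax (interp interpGen s) (interp interpGen t) ≤ ε := by
  obtain ⟨r⟩ := h
  refine iSup_le fun j => iSup_le fun S => ENNReal.ofReal_le_ofReal ?_
  obtain rfl : j = 0 := Subsingleton.elim _ _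
  have hA : ∀ i : Fin 3, (interp interpGen (Term.par (cc r) del)).mat i 0 =
      ![(r : ℝ), 1 - r, 0] i := by
    intro i
    have e : (interp interpGen (Term.par (cc r) del)).mat i 0 =
      ent (interp interpGen (Term.par (cc r) del)) i 0 := by simp [ent]
    rw [e]
    fin_cases i <;> simp [interp, ent_directSum, ent_cc]
  have hB : ∀ i : Fin 3, (interp interpGen (Term.par del (cc (unitInterval.symm r)))).mat i 0 =
      ![0, 1 - (r : ℝ), r] i := by
    intro i
    have e : (interp interpGen (Term.par del (cc (unitInterval.symm r)))).mat i 0 =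
      ent (interp interpGen (Term.par del (cc (unitInterval.symm r)))) i 0 := by simp [ent]
    rw [e]
    fin_cases i <;> simp [interp, ent_directSum, ent_cc]
  have h0 := r.2.1
  have key : |∑ i ∈ S, (![(r : ℝ), 1 - r, 0] i - ![0, 1 - (r : ℝ), r] i)| ≤ r := by
    rw [← Finset.univ_inter S, ← Finset.sum_ite_mem, Fin.sum_univ_three]
    split_ifs <;> simp [h0, abs_of_nonneg]
  rw [← Finset.sum_sub_distrib]
  refine le_trans (le_of_eq ?_) key
  exact congrArg _ (Finset.sum_congr rfl fun i _ => by rw [← hA, ← hB])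

/-- Derivable distances bound the distances of the denoted matrices. -/
lemma tvmax_le_of_derivable {n m : ℕ} {s t : Term BarAlg.Gen n m} {ε : ℝ≥0∞}
    (h : BarAlg.Derivable s t ε) : tvmax (interp interpGen s) (interp interpGen t) ≤ ε := by
  induction h with
  | ax h => exact tvmax_le_of_tvEq h
  | refl h =>
    rw [interp_eq_of_provable (fun _ _ h => interp_eq_of_convEq h) h]
    exact (edist_self (interp interpGen _)).le
  | triang _ _ ih ih' =>
    exact (edist_triangle (interp interpGen _) (interp interpGen _) _).trans (add_le_add ih ih')
  | bot => exact le_top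
  | mon _ hε ih => exact ih.trans hε
  | join S _ ih => exact le_sInf ih
  | seq _ _ ih ih' => exact (tvmax_comp_le _ _ _ _).trans (add_le_add ih ih')
  | par _ _ ih ih' => exact (tvmax_directSum_le _ _ _ _).trans (max_le_max ih ih')
  | symm _ ih => exact (edist_comm (interp interpGen _) (interp interpGen _)).trans_le ih

/-! ### Completeness of the axiom (TV) -/

namespace Wires

open scoped MonObj
open Barycentric

/-- Two morphisms are within distance `ε` if this is derivable for terms denoting them. -/
def Near {a b : Wires ConvAlg} (ε : ℝ≥0∞) (f g : a ⟶ b) : Prop :=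
  ∃ s t : Term ConvGen a.num b.num, cls s = f ∧ cls t = g ∧ BarAlg.Derivable s t ε

lemma near_cls {n m : ℕ} {s t : Term ConvGen n m} {ε : ℝ≥0∞} :
    Near ε (cls (T := ConvAlg) s) (cls t) ↔ BarAlg.Derivable s t ε := by
  refine ⟨?_, fun h => ⟨s, t, rfl, rfl, h⟩⟩
  rintro ⟨s', t', hs, ht, h⟩
  have hs' : BarAlg.Derivable s s' 0 := .refl (cls_eq_cls.1 hs).symm
  have ht' : BarAlg.Derivable t' t 0 := .refl (cls_eq_cls.1 ht)
  simpa using (hs'.triang h).triang ht'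

lemma Near.refl {a b : Wires ConvAlg} (f : a ⟶ b) : Near 0 f f := by
  obtain ⟨s, rfl⟩ := cls_surjective f
  exact ⟨s, s, rfl, rfl, .refl (.refl s)⟩

lemma Near.mono {a b : Wires ConvAlg} {f g : a ⟶ b} {ε ε' : ℝ≥0∞} (h : Near ε f g)
    (hε : ε ≤ ε') : Near ε' f g := by
  obtain ⟨s, t, hs, ht, h⟩ := h
  exact ⟨s, t, hs, ht, h.mon hε⟩

lemma Near.comp_right {a b c : Wires ConvAlg} {f g : a ⟶ b} {ε : ℝ≥0∞} (h : Near ε f g)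
    (k : b ⟶ c) : Near ε (f ≫ k) (g ≫ k) := by
  obtain ⟨s, t, rfl, rfl, h⟩ := h
  obtain ⟨u, rfl⟩ := cls_surjective k
  have h' : BarAlg.Derivable (seq s u) (seq t u) (ε + 0) := .seq h (.refl (.refl u))
  rw [add_zero] at h'
  exact ⟨_, _, rfl, rfl, h'⟩

lemma Near.tensorHom {a a' b b' : Wires ConvAlg} {f g : a ⟶ a'} {f' g' : b ⟶ b'} {ε ε' : ℝ≥0∞}
    (h : Near ε f g) (h' : Near ε' f' g') : Near (max ε ε') (f ⊗ₘ f') (g ⊗ₘ g') := by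
  obtain ⟨s, t, rfl, rfl, h⟩ := h
  obtain ⟨s', t', rfl, rfl, h'⟩ := h'
  exact ⟨_, _, rfl, rfl, h.par h'⟩

/-- The rule for `⊗` keeps the common bound, and postcomposing with the multiplication costs
nothing; hence distances can be bounded column by column. -/
lemma Near.copair {a b c : Wires ConvAlg} {f g : a ⟶ c} {f' g' : b ⟶ c} {ε : ℝ≥0∞}
    (h : Near ε f g) (h' : Near ε f' g') : Near ε (copair f f') (copair g g') := by
  have := (h.tensorHom h').comp_right μ[c]
  rwa [max_self] at this

lemma one_eq_cls_del : η[(mk 1 : Wires ConvAlg)] = cls del := by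
  rw [monObj_one]
  rfl

/-- The equation (TV), applied to three morphisms. -/
lemma near_mix {c : Wires ConvAlg} (r : unitInterval) (x y z : mk 1 ⟶ c) :
    Near (ENNReal.ofReal r) (mix r x y) (mix (unitInterval.symm r) y z) := by
  have h : Near (a := mk 1) (b := (mk 1 ⊗ mk 1) ⊗ mk 1) (ENNReal.ofReal r)
      (cls (n := 1) (m := 3) (Term.par (cc r) del))
      (cls (n := 1) (m := 3) (Term.par del (cc (unitInterval.symm r)))) :=
    near_cls.2 (.ax (.tv r))
  -- The third output of the left side and the first of the right side come from `del`, so `z` and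
  -- `x` respectively are reduced to the unit and disappear.
  have h' := h.comp_right (QMon.copair (QMon.copair x y) z)
  have e1 : cls (T := ConvAlg) (n := 1) (m := 3) (Term.par (cc r) del) ≫
      QMon.copair (QMon.copair x y) z = mix r x y := by
    have e : (choice r ⊗ₘ η[mk 1]) ≫ QMon.copair (QMon.copair x y) z =
        (ρ_ (mk 1)).hom ≫ mix r x y := by
      rw [tensorHom_copair, IsMonHom.one_hom, copair_one]
      rfl
    rw [one_eq_cls_del] at e
    exact e.trans (Category.id_comp _)
  have e2 : cls (T := ConvAlg) (n := 1) (m := 3) (Term.par del (cc (unitInterval.symm r))) ≫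
      QMon.copair (QMon.copair x y) z = mix (unitInterval.symm r) y z := by
    have e : (η[mk 1] ⊗ₘ choice (unitInterval.symm r)) ≫ QMon.copair x (QMon.copair y z) =
        (λ_ (mk 1)).hom ≫ mix (unitInterval.symm r) y z := by
      rw [tensorHom_copair, IsMonHom.one_hom, one_copair]
      rfl
    rw [one_eq_cls_del] at e
    have e' : QMon.copair (QMon.copair x y) z = QMon.copair x (QMon.copair y z) :=
      (copair_copair x y z).trans (Category.id_comp _)
    refine (congrArg (_ ≫ ·) e').trans ?_
    exact e.trans (Category.id_comp _)
  rw [← e1, ← e2]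
  exact h'

end Wires

open Wires Barycentric

/-- Two distributions decompose into a common part and two parts of total mass at most
their distance. -/
lemma exists_decomposition {m : ℕ} {p q : Fin m → ℝ} (hp : p ∈ stdSimplex ℝ (Fin m))
    (hq : q ∈ stdSimplex ℝ (Fin m)) :
    ∃ d : unitInterval, ENNReal.ofReal d ≤ tv p q ∧ ∃ x ∈ stdSimplex ℝ (Fin m),
      ∃ y ∈ stdSimplex ℝ (Fin m), ∃ z ∈ stdSimplex ℝ (Fin m),
      p = (d : ℝ) • x + (1 - (d : ℝ)) • y ∧ q = (1 - (d : ℝ)) • y + (d : ℝ) • z := by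
  -- The excess mass of `p` over `q`. Both vectors have total mass 1, so it is also the excess of
  -- `q` over `p`, and the common part `min p q` has mass `1 - δ`.
  set δ : ℝ := ∑ i, max (p i - q i) 0 with hδ
  have hmin : ∀ i, min (p i) (q i) = p i - max (p i - q i) 0 := fun i => by
    rcases le_total (p i) (q i) with h | h
    · rw [min_eq_left h, max_eq_right (by linarith)]; ring
    · rw [min_eq_right h, max_eq_left (by linarith)]; ring
  have hmin' : ∀ i, min (p i) (q i) = q i - max (q i - p i) 0 := fun i => by
    rcases le_total (p i) (q i) with h | h
    · rw [min_eq_left h, max_eq_left (by linarith)]; ring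
    · rw [min_eq_right h, max_eq_right (by linarith)]; ring
  have hsum : ∑ i, min (p i) (q i) = 1 - δ := by
    simp only [hmin, Finset.sum_sub_distrib, hp.2, hδ]
  have hδ' : ∑ i, max (q i - p i) 0 = δ := by
    have : ∑ i, min (p i) (q i) = 1 - ∑ i, max (q i - p i) 0 := by
      simp only [hmin', Finset.sum_sub_distrib, hq.2]
    linarith
  have h0 : 0 ≤ δ := Finset.sum_nonneg fun i _ => le_max_right _ _
  have h1 : 0 ≤ 1 - δ := hsum ▸ Finset.sum_nonneg fun i _ => le_min (hp.1 i) (hq.1 i)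
  -- The event where `q ≤ p` witnesses the difference `δ`.
  have htv : ENNReal.ofReal δ ≤ tv p q := by
    have e : δ = ∑ i with q i ≤ p i, p i - ∑ i with q i ≤ p i, q i := by
      rw [hδ, ← Finset.sum_sub_distrib, Finset.sum_filter]
      refine Finset.sum_congr rfl fun i _ => ?_
      split_ifs with h
      · exact max_eq_left (by linarith)
      · exact max_eq_right (by linarith)
    refine le_trans ?_ (le_tv p q {i | q i ≤ p i})
    rw [← e]
    exact ENNReal.ofReal_le_ofReal (le_abs_self _)
  refine ⟨⟨δ, h0, by linarith⟩, htv, ?_⟩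
  have scale : ∀ (c : ℝ) (f : Fin m → ℝ), (∀ i, 0 ≤ f i) → ∑ i, f i = c →
      ∃ x ∈ stdSimplex ℝ (Fin m), f = c • x := by
    intro c f hf hc
    have hc0 : 0 ≤ c := hc ▸ Finset.sum_nonneg fun i _ => hf i
    rcases hc0.eq_or_lt with rfl | hc0
    -- A part of mass zero can be normalised to any distribution; `p` is one at hand.
    · refine ⟨p, hp, ?_⟩
      rw [zero_smul]
      ext i
      exact (Finset.sum_eq_zero_iff_of_nonneg fun i _ => hf i).1 hc i (Finset.mem_univ i)
    · refine ⟨c⁻¹ • f, ⟨fun i => mul_nonneg (inv_nonneg.2 hc0.le) (hf i), ?_⟩, ?_⟩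
      · simp only [Pi.smul_apply, smul_eq_mul, ← Finset.mul_sum, hc]
        exact inv_mul_cancel₀ hc0.ne'
      · rw [smul_smul, mul_inv_cancel₀ hc0.ne', one_smul]
  obtain ⟨x, hx, ex⟩ := scale δ _ (fun i => le_max_right _ _) hδ.symm
  obtain ⟨y, hy, ey⟩ := scale (1 - δ) _ (fun i => le_min (hp.1 i) (hq.1 i)) hsum
  obtain ⟨z, hz, ez⟩ := scale δ _ (fun i => le_max_right _ _) hδ'
  refine ⟨x, hx, y, hy, z, hz, ?_, ?_⟩
  · rw [← ex, ← ey]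
    ext i
    simp only [Pi.add_apply, hmin]
    ring
  · rw [← ez, ← ey]
    ext i
    simp only [Pi.add_apply, hmin']
    ring

namespace Wires

/-- By `exists_decomposition` both columns are mixtures sharing the component `y`, in the form of
the two sides of (TV); faithfulness turns this equality of weights into an equality of morphisms. -/
lemma near_of_tv_le {m : ℕ} {ε : ℝ≥0∞} (f g : (mk 1 : Wires ConvAlg) ⟶ mk m)
    (h : tv (weights f) (weights g) ≤ ε) : Near ε f g := by
  obtain ⟨d, hd, x, hx, y, hy, z, hz, hf, hg⟩ :=
    exists_decomposition (weights_mem f) (weights_mem g)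
  obtain ⟨x, rfl⟩ := exists_weights_eq hx
  obtain ⟨y, rfl⟩ := exists_weights_eq hy
  obtain ⟨z, rfl⟩ := exists_weights_eq hz
  have ef : f = mix d x y := weights_injective (by rw [hf, weights_mix])
  have eg : g = mix (unitInterval.symm d) y z := weights_injective (by
    rw [hg, weights_mix, unitInterval.coe_symm_eq, sub_sub_cancel])
  rw [ef, eg]
  exact (near_mix d x y z).mono (hd.trans h)

/-- Morphisms are as near as their matrices. -/
lemma near_of_tvmax_le {n m : ℕ} {ε : ℝ≥0∞} (f g : (mk n : Wires ConvAlg) ⟶ mk m)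
    (h : tvmax (mat f) (mat g) ≤ ε) : Near ε f g := by
  induction n with
  | zero =>
    rw [eq_one_of_zero f, eq_one_of_zero g]
    exact (Near.refl _).mono bot_le
  | succ n ih =>
    have hf := eq_copair_incl (a := mk n) (b := mk 1) f
    have hg := eq_copair_incl (a := mk n) (b := mk 1) g
    -- Precomposition does not increase `tvmax`; this is used for the inclusions of the first `n`
    -- wires and of the last wire.
    have hle : ∀ {k : ℕ} (i : (mk k : Wires ConvAlg) ⟶ mk (n + 1)),
        tvmax (mat (i ≫ f)) (mat (i ≫ g)) ≤ ε := by
      intro k i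
      rw [mat_comp, mat_comp]
      refine (tvmax_comp_le (mat i) (mat i) (mat f) (mat g)).trans ?_
      rw [show tvmax (mat i) (mat i) = 0 from edist_self (mat i), _root_.zero_add]
      exact h
    rw [hf, hg]
    refine Near.copair (ih _ _ (hle _)) (near_of_tv_le _ _ ?_)
    exact (tv_le_tvmax (n := 1) (m := m) _ _ 0).trans (hle _)

end Wires

/-! ### The inverse functor and the isomorphism -/

/-- Derivability of a distance is the corresponding bound on matrices. -/
lemma derivable_iff_tvmax_le {n m : ℕ} (s t : Term BarAlg.Gen n m) (ε : ℝ≥0∞) :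
    BarAlg.Derivable s t ε ↔ tvmax (interp interpGen s) (interp interpGen t) ≤ ε :=
  ⟨tvmax_le_of_derivable, fun h => near_cls.1 (near_of_tvmax_le (cls s) (cls t) h)⟩

/-- A choice of terms denoting a stochastic matrix. -/
def termOf {n m : ℕ} (A : StochMat n m) : Term BarAlg.Gen n m :=
  (cls_surjective (mat_surjective A).choose).choose

lemma interp_termOf {n m : ℕ} (A : StochMat n m) : interp interpGen (termOf A) = A := by
  have h := (cls_surjective (mat_surjective A).choose).choose_spec
  have h' := (mat_surjective A).choose_spec
  rw [← h] at h'
  exact h'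

lemma provable_of_interp_eq {n m : ℕ} {s t : Term BarAlg.Gen n m}
    (h : interp interpGen s = interp interpGen t) : BarAlg.Provable s t :=
  cls_eq_cls.1 (mat_injective h)

/-- The inverse of `fritzFunctor`. -/
def fritzInverse : FStoch ⥤ Syn BarAlg where
  obj n := n
  map {n m} A := Quotient.mk (BarAlg.setoid n m) (termOf A)
  map_id n := Quotient.sound (s := BarAlg.setoid n n) (provable_of_interp_eq
    ((interp_termOf _).trans (fritzFunctor.map_id n).symm))
  map_comp {n _ l} A B := Quotient.sound (s := BarAlg.setoid n l) (provable_of_interp_eq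
    ((interp_termOf _).trans (congrArg₂ StochMat.comp (interp_termOf A) (interp_termOf B)).symm))

/-- The syntactic distance is itself derivable by the join rule, so soundness gives one inequality
and completeness at the exact value of `tvmax` the other. -/
lemma edist_fritzFunctor_map {n m : Syn BarAlg} (f g : n ⟶ m) :
    edist (fritzFunctor.map f) (fritzFunctor.map g) = edist f g := by
  refine Quotient.inductionOn₂ f g fun s t => ?_
  refine le_antisymm (tvmax_le_of_derivable (BarAlg.derivable_termDist s t)) ?_
  exact BarAlg.termDist_le ((derivable_iff_tvmax_le s t _).2 le_rfl)

lemma fritzFunctor_map_inverse {n m : FStoch} (A : n ⟶ m) :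
    fritzFunctor.map (fritzInverse.map A) = A := interp_termOf A

lemma fritzInverse_map_functor {n m : Syn BarAlg} (f : n ⟶ m) :
    fritzInverse.map (fritzFunctor.map f) = f :=
  Quotient.inductionOn f fun _ => Quotient.sound (s := BarAlg.setoid n m)
    (provable_of_interp_eq (interp_termOf _))

lemma isEnrichedIso_fritzFunctor : IsEnrichedIso fritzFunctor := by
  refine ⟨fun _ _ f g => (edist_fritzFunctor_map f g).le, fritzInverse, fun _ _ A B => ?_, ?_, ?_⟩
  -- The inverse of an isometry is an isometry.
  · rw [← edist_fritzFunctor_map, fritzFunctor_map_inverse, fritzFunctor_map_inverse]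
    exact le_rfl
  · refine Functor.hext (fun _ => rfl) fun _ _ f => heq_of_eq ?_
    exact fritzInverse_map_functor f
  · refine Functor.hext (fun _ => rfl) fun _ _ f => heq_of_eq ?_
    exact fritzFunctor_map_inverse f

end QMon

theorem mainTheorem4 :
    QMon.IsEnrichedIso QMon.fritzFunctor ∧
      ∀ (n m : ℕ) (s t : QMon.Term QMon.BarAlg.Gen n m) (ε : ℝ≥0∞),
        QMon.BarAlg.Derivable s t ε ↔
          QMon.tvmax (QMon.interp QMon.interpGen s) (QMon.interp QMon.interpGen t) ≤ ε :=
  ⟨QMon.isEnrichedIso_fritzFunctor, fun _ _ => QMon.derivable_iff_tvmax_le⟩
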